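/- Let $(X,d)$ be a complete metric space with a Borel measure $\mu$ that is doubling, i.e. there is $C_d>1$ with $0<\mu(B(x,2r))\le C_d\,\mu(B(x,r))<\infty$ for all $x\in X$, $r>0$, where $B(x,r)$ is the open ball. Suppose that $X$ satisfies an annular decay property: there are $0\le\alpha\le1$ and $C\ge1$ such that $\mu\big(B(x,r)\setminus B(x,(1-\delta)r)\big)\le C\delta^\alpha\mu(B(x,r))$ for all $x\in X$, $r>0$, $0<\delta<1$. Let $1<p,s<\infty$. For a nonnegative measurable function $f$ and a ball $B$ write $\langle f\rangle_B=\mu(B)^{-1}\int_B f\,d\mu$. For a nonnegative function $w\in L^1_{\mathrm{loc}}(X)$, with $B$ ranging over all open balls (and $0^{-1/(p-1)}=\infty$, $0\cdot\infty=0$), say that - $w\in A_p(X)$ if $\sup_B\big(\langle w\rangle_B\big)\big(\langle w^{-1/(p-1)}\rangle_B\big)^{p-1}<\infty$; - $w\in A_1(X)$ if there is $C<\infty$ with $\langle w\rangle_B\le C\operatorname{ess\,inf}_B w$ for every $B$; - $w\in RH_s(X)$ if there is $C<\infty$ with $\big(\langle w^s\rangle_B\big)^{1/s}\le C\langle w\rangle_B$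 for every $B$; - $w\in RH_\infty(X)$ if there is $C<\infty$ with $\operatorname{ess\,sup}_B w\le C\langle w\rangle_B$ for every $B$. Then $w\in A_p(X)\cap RH_s(X)$ if and only if $w=w_1w_2$ almost everywhere for some $w_1\in A_1(X)\cap RH_s(X)$ and $w_2\in A_p(X)\cap RH_\infty(X)$. -/

import Mathlib

open MeasureTheory Metric Set
open scoped ENNReal NNReal

namespace JonesFactorization

variable {X : Type*} [MetricSpace X] [MeasurableSpace X]

/-- `μ` is doubling: `0 < μ(2B) ≤ C_d μ(B) < ∞` for all open balls `B`, with some `C_d > 1`. -/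
def IsDoubling (μ : Measure X) : Prop :=
  ∃ C : ℝ≥0, 1 < C ∧ ∀ (x : X) (r : ℝ), 0 < r →
    0 < μ (ball x (2 * r)) ∧ μ (ball x (2 * r)) ≤ C * μ (ball x r) ∧ C * μ (ball x r) < ∞

/-- The `α`-annular decay property. -/
def HasAnnularDecayWith (μ : Measure X) (α : ℝ) : Prop :=
  ∃ C : ℝ, 1 ≤ C ∧ ∀ (x : X) (r δ : ℝ), 0 < r → 0 < δ → δ < 1 →
    μ (ball x r \ ball x ((1 - δ) * r)) ≤ ENNReal.ofReal (C * δ ^ α) * μ (ball x r)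

/-- An annular decay property: the `α`-annular decay property for some `0 ≤ α ≤ 1`. -/
def HasAnnularDecay (μ : Measure X) : Prop :=
  ∃ α : ℝ, 0 ≤ α ∧ α ≤ 1 ∧ HasAnnularDecayWith μ α

/-- A weight: a nonnegative locally integrable function. -/
def IsWeight (μ : Measure X) (w : X → ℝ) : Prop :=
  0 ≤ᵐ[μ] w ∧ LocallyIntegrable w μ

/-- The Muckenhoupt constant `[w]_{A_p}`, for `1 < p < ∞`. Powers and averages are taken in
`[0, ∞]`, so that `w ^ (-1 / (p - 1))` is `∞` where `w` vanishes. -/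
noncomputable def muckenhouptConst (μ : Measure X) (p : ℝ) (w : X → ℝ) : ℝ≥0∞ :=
  ⨆ (x : X) (r : ℝ) (_ : 0 < r),
    (⨍⁻ y in ball x r, ENNReal.ofReal (w y) ∂μ) *
      (⨍⁻ y in ball x r, ENNReal.ofReal (w y) ^ (-(1 / (p - 1))) ∂μ) ^ (p - 1)

/-- The Muckenhoupt class `A_p`, for `1 < p < ∞`. -/
def MuckenhouptA (μ : Measure X) (p : ℝ) (w : X → ℝ) : Prop :=
  IsWeight μ w ∧ muckenhouptConst μ p w < ∞

/-- The Muckenhoupt class `A_1`. -/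
def MuckenhouptAOne (μ : Measure X) (w : X → ℝ) : Prop :=
  IsWeight μ w ∧ ∃ C : ℝ≥0, ∀ (x : X) (r : ℝ), 0 < r →
    ⨍⁻ y in ball x r, ENNReal.ofReal (w y) ∂μ ≤
      C * essInf (fun y => ENNReal.ofReal (w y)) (μ.restrict (ball x r))

/-- The reverse Hölder class `RH_s`, for `1 < s < ∞`. -/
def ReverseHolder (μ : Measure X) (s : ℝ) (w : X → ℝ) : Prop :=
  IsWeight μ w ∧ ∃ C : ℝ≥0, ∀ (x : X) (r : ℝ), 0 < r →
    (⨍⁻ y in ball x r, ENNReal.ofReal (w y) ^ s ∂μ) ^ (1 / s) ≤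
      C * ⨍⁻ y in ball x r, ENNReal.ofReal (w y) ∂μ

/-- The reverse Hölder class `RH_∞`. -/
def ReverseHolderTop (μ : Measure X) (w : X → ℝ) : Prop :=
  IsWeight μ w ∧ ∃ C : ℝ≥0, ∀ (x : X) (r : ℝ), 0 < r →
    essSup (fun y => ENNReal.ofReal (w y)) (μ.restrict (ball x r)) ≤
      C * ⨍⁻ y in ball x r, ENNReal.ofReal (w y) ∂μ

end JonesFactorization

/-!
If `w ∈ A_p ∩ RH_s`, then `w ^ s` satisfies the `A_P` condition with `P = s (p - 1) + 1`, its dual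
weight being that of `w`. By Muckenhoupt's theorem the maximal operator `M` is bounded on the two
dual weighted spaces, so summing the iterates of a combination of two weighted maximal operators
(Rubio de Francia) produces a single function whose weighted powers are `A_1` weights `v₁`, `v₂`
with `w ^ s = v₁ v₂ ^ (1 - P)`. Taking `s`-th roots, `w = v₁ ^ (1 / s) v₂ ^ (1 - p)`, and by
Jensen's inequality these powers of `A_1` weights lie in `A_1 ∩ RH_s` and `A_p ∩ RH_∞`.

Conversely, on each ball an `A_1` weight is essentially bounded below, and an `RH_∞` weight
essentially bounded above, by a multiple of its average, so averages of powers of `w₁ w₂` are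
comparable to products of averages.
-/

namespace JonesFactorization

lemma mul_rpow_sub_one {p : ℝ} (hp : 1 ≤ p) (x : ℝ≥0∞) : x * x ^ (p - 1) = x ^ p := by
  conv_lhs => rw [← ENNReal.rpow_one x, ← ENNReal.rpow_mul, one_mul]
  rw [← ENNReal.rpow_add_of_nonneg _ _ zero_le_one (sub_nonneg.2 hp), add_sub_cancel]

/-! ### Averages -/

section Average

variable {Y : Type*} [MeasurableSpace Y] {ν : Measure Y}

lemma laverage_const_mul {f : Y → ℝ≥0∞} (hf : AEMeasurable f ν) (c : ℝ≥0∞) :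
    ⨍⁻ y, c * f y ∂ν = c * ⨍⁻ y, f y ∂ν := by
  rw [laverage_eq, laverage_eq, lintegral_const_mul'' _ hf, mul_div_assoc]

lemma laverage_le_of_ae_le {f : Y → ℝ≥0∞} {c : ℝ≥0∞} (h : ∀ᵐ y ∂ν, f y ≤ c) :
    ⨍⁻ y, f y ∂ν ≤ c :=
  (laverage_le_essSup f).trans (essSup_le_of_ae_le c h)

lemma mul_measure_le_of_lt_setLAverage {f : Y → ℝ≥0∞} {s : Set Y} {c : ℝ≥0∞}
    (h : c < ⨍⁻ y in s, f y ∂ν) : c * ν s ≤ ∫⁻ y in s, f y ∂ν := by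
  rw [setLAverage_eq] at h
  exact ENNReal.mul_le_of_le_div h.le

end Average

/-! ### Doubling measures -/

section Doubling

variable {X : Type*} [MetricSpace X] [MeasurableSpace X] {μ : Measure X}

lemma IsDoubling.measure_ball_pos (hμ : IsDoubling μ) (x : X) {r : ℝ} (hr : 0 < r) :
    0 < μ (ball x r) := by
  obtain ⟨C, -, h⟩ := hμ
  simpa [mul_div_cancel₀] using (h x (r / 2) (by positivity)).1

lemma IsDoubling.measure_ball_lt_top (hμ : IsDoubling μ) (x : X) (r : ℝ) :
    μ (ball x r) < ∞ := by
  rcases le_or_gt r 0 with hr | hr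
  · simp [ball_eq_empty.2 hr]
  obtain ⟨C, hC, h⟩ := hμ
  exact ENNReal.lt_top_of_mul_ne_top_right (h x r hr).2.2.ne
    (by simpa using (zero_lt_one.trans hC).ne')

lemma IsDoubling.exists_measure_closedBall_four_mul_le (hμ : IsDoubling μ) :
    ∃ D : ℝ≥0, ∀ (x : X) (r : ℝ), 0 < r → μ (closedBall x (4 * r)) ≤ D * μ (ball x r) := by
  obtain ⟨C, -, h⟩ := hμ
  refine ⟨C * (C * C), fun x r hr => ?_⟩
  have double (ρ : ℝ) (hρ : 0 < ρ) : μ (ball x (2 * ρ)) ≤ C * μ (ball x ρ) := (h x ρ hρ).2.1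
  calc μ (closedBall x (4 * r))
      ≤ μ (ball x (2 * (2 * (2 * r)))) := measure_mono (closedBall_subset_ball (by linarith))
    _ ≤ C * μ (ball x (2 * (2 * r))) := double _ (by positivity)
    _ ≤ C * (C * μ (ball x (2 * r))) := by gcongr; exact double _ (by positivity)
    _ ≤ C * (C * (C * μ (ball x r))) := by gcongr; exact double r hr
    _ = ↑(C * (C * C)) * μ (ball x r) := by push_cast; ring

lemma IsDoubling.sigmaFinite (hμ : IsDoubling μ) : SigmaFinite μ := by
  rcases isEmpty_or_nonempty X with h | ⟨⟨x⟩⟩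
  · rw [Measure.eq_zero_of_isEmpty μ]; infer_instance
  · exact ⟨⟨⟨fun n => ball x n, fun _ => trivial, fun n => hμ.measure_ball_lt_top x n,
      iUnion_ball_nat x⟩⟩⟩

variable [BorelSpace X]

lemma IsDoubling.countable_of_pairwiseDisjoint (hμ : IsDoubling μ) {ι : Type*} {u : Set ι}
    {x : ι → X} {r : ι → ℝ} (hr : ∀ a ∈ u, 0 < r a)
    (hu : u.PairwiseDisjoint fun a => ball (x a) (r a)) : u.Countable := by
  have := hμ.sigmaFinite
  have hcount := Measure.countable_meas_pos_of_disjoint_iUnion (μ := μ)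
    (As := fun a : u => ball (x a) (r a)) (fun _ => measurableSet_ball)
    fun a b hab => hu a.2 b.2 (Subtype.coe_injective.ne hab)
  have hall : {a : u | 0 < μ (ball (x a) (r a))} = univ :=
    eq_univ_of_forall fun a => hμ.measure_ball_pos (x a) (hr a a.2)
  rwa [hall, countable_univ_iff] at hcount

lemma IsDoubling.secondCountableTopology (hμ : IsDoubling μ) : SecondCountableTopology X := by
  refine Metric.secondCountable_of_almost_dense_set fun ε hε => ?_
  obtain ⟨u, -, hu, hcov⟩ := Vitali.exists_disjoint_subfamily_covering_enlargement_closedBall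
    (univ : Set X) id (fun _ => ε / 4) (ε / 4) (fun _ _ => le_rfl) 4 (by norm_num)
  have hball : u.PairwiseDisjoint fun a : X => ball (id a) (ε / 4) :=
    hu.mono fun _ => ball_subset_closedBall
  refine ⟨u, hμ.countable_of_pairwiseDisjoint (fun _ _ => by positivity) hball, fun x => ?_⟩
  obtain ⟨b, hb, hxb⟩ := hcov x (mem_univ x)
  refine ⟨b, hb, ?_⟩
  simpa [mem_closedBall, mul_div_cancel₀] using hxb (mem_closedBall_self (by positivity))

end Doubling

/-! ### The Hardy–Littlewood maximal theorem -/

section Maximal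

variable {X : Type*} [MetricSpace X] [MeasurableSpace X] {μ : Measure X}

/-- The uncentred Hardy–Littlewood maximal function of `g` with respect to `μ`: the supremum of the
averages of `g` over the open balls containing the given point. -/
noncomputable def maximal (μ : Measure X) (g : X → ℝ≥0∞) (x : X) : ℝ≥0∞ :=
  ⨆ (z : X) (r : ℝ) (_ : x ∈ ball z r), ⨍⁻ y in ball z r, g y ∂μ

lemma setLAverage_le_maximal (μ : Measure X) (g : X → ℝ≥0∞) {x z : X} {r : ℝ}
    (hx : x ∈ ball z r) : ⨍⁻ y in ball z r, g y ∂μ ≤ maximal μ g x :=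
  le_iSup_of_le z (le_iSup₂_of_le r hx le_rfl)

lemma maximal_le {g : X → ℝ≥0∞} {x : X} {c : ℝ≥0∞}
    (h : ∀ z r, x ∈ ball z r → ⨍⁻ y in ball z r, g y ∂μ ≤ c) : maximal μ g x ≤ c :=
  iSup_le fun z => iSup₂_le fun r hx => h z r hx

lemma lt_maximal_iff {g : X → ℝ≥0∞} {x : X} {c : ℝ≥0∞} :
    c < maximal μ g x ↔ ∃ z r, x ∈ ball z r ∧ c < ⨍⁻ y in ball z r, g y ∂μ := by
  simp only [maximal, lt_iSup_iff, exists_prop]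

lemma maximal_le_maximal_indicator_add (g : X → ℝ≥0∞) (c : ℝ≥0∞) (x : X) :
    maximal μ g x ≤ maximal μ ({y | c < g y}.indicator g) x + c := by
  refine maximal_le fun z r hx => ?_
  calc ⨍⁻ y in ball z r, g y ∂μ
      ≤ ⨍⁻ y in ball z r, ({y | c < g y}.indicator g y + c) ∂μ := by
        refine setLAverage_mono_ae _ (.of_forall fun y => ?_)
        by_cases h : c < g y
        · simp [h]
        · simpa [h] using not_lt.1 h
    _ = ⨍⁻ y in ball z r, {y | c < g y}.indicator g y ∂μ + ⨍⁻ _ in ball z r, c ∂μ := by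
        rw [laverage_eq, laverage_eq, laverage_eq, ← ENNReal.add_div,
          lintegral_add_right _ measurable_const]
    _ ≤ maximal μ ({y | c < g y}.indicator g) x + c :=
        add_le_add (setLAverage_le_maximal μ _ hx)
          (laverage_le_of_ae_le (.of_forall fun _ => le_rfl))

variable [BorelSpace X]

lemma measurable_maximal (μ : Measure X) (g : X → ℝ≥0∞) : Measurable (maximal μ g) := by
  refine measurable_of_Ioi fun c => IsOpen.measurableSet (Metric.isOpen_iff.2 fun x hx => ?_)
  obtain ⟨z, r, hxz, h⟩ := lt_maximal_iff.1 hx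
  obtain ⟨ε, hε, hsub⟩ := Metric.isOpen_iff.1 (isOpen_ball (x := z) (ε := r)) x hxz
  exact ⟨ε, hε, fun y hy => lt_maximal_iff.2 ⟨z, r, hsub hy, h⟩⟩

lemma IsDoubling.mul_measure_le_of_radius_le (hμ : IsDoubling μ) {D : ℝ≥0}
    (hD : ∀ (x : X) (r : ℝ), 0 < r → μ (closedBall x (4 * r)) ≤ D * μ (ball x r))
    (g : X → ℝ≥0∞) (c : ℝ≥0∞) (R : ℝ) :
    c * μ {x | ∃ z r, x ∈ ball z r ∧ r ≤ R ∧ c < ⨍⁻ y in ball z r, g y ∂μ} ≤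
      D * ∫⁻ y, g y ∂μ := by
  obtain ⟨u, hut, hu, hcov⟩ := Vitali.exists_disjoint_subfamily_covering_enlargement_closedBall
    {a : X × ℝ | 0 < a.2 ∧ a.2 ≤ R ∧ c < ⨍⁻ y in ball a.1 a.2, g y ∂μ} Prod.fst Prod.snd R
    (fun a ha => ha.2.1) 4 (by norm_num)
  have hdisj : u.PairwiseDisjoint fun a => ball a.1 a.2 := hu.mono fun _ => ball_subset_closedBall
  have hcount : u.Countable := hμ.countable_of_pairwiseDisjoint (fun a ha => (hut ha).1) hdisj
  have hsub : {x | ∃ z r, x ∈ ball z r ∧ r ≤ R ∧ c < ⨍⁻ y in ball z r, g y ∂μ} ⊆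
      ⋃ b ∈ u, closedBall b.1 (4 * b.2) := by
    rintro x ⟨z, r, hx, hr, h⟩
    obtain ⟨b, hb, hsb⟩ := hcov (z, r) ⟨pos_of_mem_ball hx, hr, h⟩
    exact mem_biUnion hb (hsb (ball_subset_closedBall hx))
  have henlarge (b : u) : c * μ (closedBall b.1.1 (4 * b.1.2)) ≤
      D * ∫⁻ y in ball b.1.1 b.1.2, g y ∂μ :=
    calc c * μ (closedBall b.1.1 (4 * b.1.2))
        ≤ c * (D * μ (ball b.1.1 b.1.2)) := by gcongr; exact hD _ _ (hut b.2).1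
      _ = D * (c * μ (ball b.1.1 b.1.2)) := by ring
      _ ≤ D * ∫⁻ y in ball b.1.1 b.1.2, g y ∂μ := by
          gcongr; exact mul_measure_le_of_lt_setLAverage (hut b.2).2.2
  calc c * μ {x | ∃ z r, x ∈ ball z r ∧ r ≤ R ∧ c < ⨍⁻ y in ball z r, g y ∂μ}
      ≤ c * ∑' b : u, μ (closedBall b.1.1 (4 * b.1.2)) := by
        gcongr; exact (measure_mono hsub).trans (measure_biUnion_le μ hcount _)
    _ ≤ ∑' b : u, D * ∫⁻ y in ball b.1.1 b.1.2, g y ∂μ := by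
        rw [← ENNReal.tsum_mul_left]; exact ENNReal.tsum_le_tsum henlarge
    _ = D * ∫⁻ y in ⋃ b ∈ u, ball b.1 b.2, g y ∂μ := by
        rw [ENNReal.tsum_mul_left, lintegral_biUnion hcount (fun _ _ => measurableSet_ball) hdisj]
    _ ≤ D * ∫⁻ y, g y ∂μ := by gcongr; exact Measure.restrict_le_self

lemma IsDoubling.exists_mul_measure_lt_maximal_le (hμ : IsDoubling μ) :
    ∃ D : ℝ≥0, ∀ (g : X → ℝ≥0∞) (c : ℝ≥0∞),
      c * μ {x | c < maximal μ g x} ≤ D * ∫⁻ y, g y ∂μ := by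
  obtain ⟨D, hD⟩ := hμ.exists_measure_closedBall_four_mul_le
  refine ⟨D, fun g c => ?_⟩
  let level (R : ℝ) : Set X :=
    {x | ∃ z r, x ∈ ball z r ∧ r ≤ R ∧ c < ⨍⁻ y in ball z r, g y ∂μ}
  have hunion : {x | c < maximal μ g x} = ⋃ n : ℕ, level n := by
    ext x
    simp only [level, mem_ofPred_eq, mem_iUnion, lt_maximal_iff]
    constructor
    · rintro ⟨z, r, hx, h⟩
      obtain ⟨n, hn⟩ := exists_nat_ge r
      exact ⟨n, z, r, hx, hn, h⟩
    · rintro ⟨n, z, r, hx, -, h⟩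
      exact ⟨z, r, hx, h⟩
  have hmono : Monotone fun n : ℕ => level n := by
    rintro m n hmn x ⟨z, r, hx, hr, h⟩
    exact ⟨z, r, hx, hr.trans (by exact_mod_cast hmn), h⟩
  rw [hunion, hmono.measure_iUnion, ENNReal.mul_iSup]
  exact iSup_le fun n => hμ.mul_measure_le_of_radius_le hD g c n

-- Splitting `g` at height `c / 2` leaves a part that is large only where `c < 2 * g`.
lemma IsDoubling.exists_mul_measure_lt_maximal_le_setLIntegral (hμ : IsDoubling μ) :
    ∃ D : ℝ≥0, ∀ g : X → ℝ≥0∞, Measurable g → ∀ c : ℝ≥0∞,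
      c * μ {x | c < maximal μ g x} ≤ D * ∫⁻ y in {y | c < 2 * g y}, g y ∂μ := by
  obtain ⟨D, hD⟩ := hμ.exists_mul_measure_lt_maximal_le
  refine ⟨2 * D, fun g hg c => ?_⟩
  have hset : {y | c / 2 < g y} = {y | c < 2 * g y} := by
    ext y
    rw [mem_ofPred_eq, mem_ofPred_eq, ENNReal.div_lt_iff (by simp) (by simp), mul_comm]
  have hsub : {x | c < maximal μ g x} ⊆
      {x | c / 2 < maximal μ ({y | c / 2 < g y}.indicator g) x} := by
    intro x hx
    by_contra! hle
    refine absurd (lt_of_lt_of_le hx (maximal_le_maximal_indicator_add g (c / 2) x)) (not_lt.2 ?_)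
    exact (add_le_add_left (not_lt.1 hle) _).trans (ENNReal.add_halves c).le
  calc c * μ {x | c < maximal μ g x}
      = 2 * (c / 2 * μ {x | c < maximal μ g x}) := by
        rw [← mul_assoc, ENNReal.mul_div_cancel (by simp) (by simp)]
    _ ≤ 2 * (D * ∫⁻ y, {y | c / 2 < g y}.indicator g y ∂μ) := by
        exact mul_le_mul_right ((mul_le_mul_right (measure_mono hsub) _).trans (hD _ _)) _
    _ = ↑(2 * D) * ∫⁻ y in {y | c < 2 * g y}, g y ∂μ := by
        rw [lintegral_indicator (measurableSet_lt measurable_const hg), hset]; push_cast; ring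

lemma lintegral_rpow_eq_lintegral_measure_lt_of_ne_top {Y : Type*} [MeasurableSpace Y]
    (ν : Measure Y) {F : Y → ℝ≥0∞} (hF : Measurable F) (hne : ∀ y, F y ≠ ∞) {a : ℝ} (ha : 0 < a) :
    ∫⁻ y, F y ^ a ∂ν = ENNReal.ofReal a * ∫⁻ t in Ioi (0 : ℝ),
      ν {y | ENNReal.ofReal t < F y} * ENNReal.ofReal (t ^ (a - 1)) := by
  have hreal := lintegral_rpow_eq_lintegral_meas_lt_mul ν (f := fun y => (F y).toReal)
    (.of_forall fun _ => ENNReal.toReal_nonneg) hF.ennreal_toReal.aemeasurable ha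
  simp only [← ENNReal.ofReal_rpow_of_nonneg ENNReal.toReal_nonneg ha.le,
    ENNReal.ofReal_toReal (hne _)] at hreal
  rw [hreal]
  congr 1
  refine setLIntegral_congr_fun measurableSet_Ioi fun t (ht : 0 < t) => ?_
  simp only [ENNReal.ofReal_lt_iff_lt_toReal ht.le (hne _)]

lemma lintegral_rpow_eq_lintegral_measure_lt {Y : Type*} [MeasurableSpace Y] (ν : Measure Y)
    {F : Y → ℝ≥0∞} (hF : Measurable F) {a : ℝ} (ha : 0 < a) :
    ∫⁻ y, F y ^ a ∂ν = ENNReal.ofReal a * ∫⁻ t in Ioi (0 : ℝ),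
      ν {y | ENNReal.ofReal t < F y} * ENNReal.ofReal (t ^ (a - 1)) := by
  let level (n : ℕ) (t : ℝ) : Set Y := {y | ENNReal.ofReal t < min (F y) n}
  have hiSup (y : Y) : ⨆ n : ℕ, min (F y) n = F y := by
    rw [← inf_iSup_eq, ENNReal.iSup_natCast, inf_top_eq]
  have hmono : Monotone fun (n : ℕ) y => min (F y) n := fun m n hmn y => by
    dsimp only; gcongr
  have hlevel_mono (t : ℝ) : Monotone fun n => level n t :=
    fun m n hmn y hy => lt_of_lt_of_le hy (hmono hmn y)
  have hlevel (t : ℝ) : ⨆ n, ν (level n t) = ν {y | ENNReal.ofReal t < F y} := by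
    rw [← (hlevel_mono t).measure_iUnion]
    congr 1
    ext y
    simp only [level, mem_iUnion, mem_ofPred_eq, ← lt_iSup_iff, hiSup]
  calc ∫⁻ y, F y ^ a ∂ν = ∫⁻ y, ⨆ n : ℕ, min (F y) n ^ a ∂ν := by
        refine lintegral_congr fun y => ?_
        exact (congrArg (· ^ a) (hiSup y)).symm.trans
          ((ENNReal.orderIsoRpow a ha).map_iSup fun n : ℕ => min (F y) n)
    _ = ⨆ n : ℕ, ∫⁻ y, min (F y) n ^ a ∂ν :=
        lintegral_iSup (fun n => (hF.min measurable_const).pow_const a)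
          fun m n hmn y => ENNReal.rpow_le_rpow (hmono hmn y) ha.le
    _ = ENNReal.ofReal a * ∫⁻ t in Ioi (0 : ℝ),
          ⨆ n, ν (level n t) * ENNReal.ofReal (t ^ (a - 1)) := by
        simp only [fun n : ℕ => lintegral_rpow_eq_lintegral_measure_lt_of_ne_top ν
          (hF.min measurable_const)
          (fun _ => (min_lt_of_right_lt (ENNReal.natCast_lt_top n)).ne) ha]
        rw [← ENNReal.mul_iSup, lintegral_iSup]
        · intro n
          have hanti : Antitone fun t => ν (level n t) := fun t u htu =>
            measure_mono fun y hy => (ENNReal.ofReal_le_ofReal htu).trans_lt hy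
          exact hanti.measurable.mul (by fun_prop)
        · intro m n hmn t
          exact mul_le_mul_left (measure_mono (hlevel_mono t hmn)) _
    _ = _ := by simp only [← ENNReal.iSup_mul, hlevel]

theorem IsDoubling.exists_lintegral_maximal_rpow_le (hμ : IsDoubling μ) {q : ℝ} (hq : 1 < q) :
    ∃ K : ℝ≥0, ∀ g : X → ℝ≥0∞, Measurable g →
      ∫⁻ x, maximal μ g x ^ q ∂μ ≤ K * ∫⁻ x, g x ^ q ∂μ := by
  obtain ⟨D, hD⟩ := hμ.exists_mul_measure_lt_maximal_le_setLIntegral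
  have hq_sub : 0 < q - 1 := by linarith
  refine ⟨(q / (q - 1)).toNNReal * D * 2 ^ (q - 1), fun g hg => ?_⟩
  have hq_mul : ENNReal.ofReal q = ENNReal.ofReal (q / (q - 1)) * ENNReal.ofReal (q - 1) := by
    rw [← ENNReal.ofReal_mul (by positivity), div_mul_cancel₀ _ hq_sub.ne']
  have hpow (y : X) : g y * (2 * g y) ^ (q - 1) = 2 ^ (q - 1) * g y ^ q := by
    rw [ENNReal.mul_rpow_of_nonneg _ _ hq_sub.le, mul_left_comm,
      mul_rpow_sub_one hq.le]
  calc ∫⁻ x, maximal μ g x ^ q ∂μ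
      = ENNReal.ofReal q * ∫⁻ t in Ioi (0 : ℝ),
          μ {x | ENNReal.ofReal t < maximal μ g x} * ENNReal.ofReal (t ^ (q - 1)) :=
        lintegral_rpow_eq_lintegral_measure_lt μ (measurable_maximal μ g) (by linarith)
    _ ≤ ENNReal.ofReal q * ∫⁻ t in Ioi (0 : ℝ), D * (μ.withDensity g
          {y | ENNReal.ofReal t < 2 * g y} * ENNReal.ofReal (t ^ (q - 1 - 1))) := by
        gcongr 1
        refine setLIntegral_mono' measurableSet_Ioi fun t (ht : 0 < t) => ?_
        have ht_pow : ENNReal.ofReal (t ^ (q - 1)) =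
            ENNReal.ofReal t * ENNReal.ofReal (t ^ (q - 1 - 1)) := by
          rw [← ENNReal.ofReal_mul ht.le, Real.rpow_sub_one ht.ne' (q - 1),
            mul_div_cancel₀ _ ht.ne']
        rw [ht_pow, withDensity_apply _ (measurableSet_lt measurable_const (hg.const_mul 2)),
          ← mul_assoc, ← mul_assoc, mul_comm (μ _)]
        exact mul_le_mul_left (hD g hg _) _
    _ = ENNReal.ofReal (q / (q - 1)) * D * ∫⁻ y, (2 * g y) ^ (q - 1) ∂μ.withDensity g := by
        rw [lintegral_rpow_eq_lintegral_measure_lt _ (hg.const_mul 2) hq_sub,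
          lintegral_const_mul' _ _ ENNReal.coe_ne_top, hq_mul]
        ring
    _ = ENNReal.ofReal (q / (q - 1)) * D * (2 ^ (q - 1) * ∫⁻ y, g y ^ q ∂μ) := by
        rw [lintegral_withDensity_eq_lintegral_mul _ hg ((hg.const_mul 2).pow_const _)]
        simp only [Pi.mul_apply, hpow]
        rw [lintegral_const_mul _ (hg.pow_const q)]
    _ = _ := by
        rw [ENNReal.coe_mul, ENNReal.coe_mul, ENNReal.coe_rpow_of_nonneg _ hq_sub.le,
          ENNReal.ofReal, ENNReal.coe_ofNat]
        ring

end Maximal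

/-! ### Muckenhoupt's theorem -/

lemma measure_univ_le_lintegral_rpow_mul {Y : Type*} [MeasurableSpace Y] {ν : Measure Y} {p q : ℝ}
    (hpq : p.HolderConjugate q) {F G : Y → ℝ≥0∞} (hF : AEMeasurable F ν) (hG : AEMeasurable G ν)
    (hFG : ∀ᵐ y ∂ν, F y ^ p⁻¹ * G y ^ q⁻¹ = 1) :
    ν univ ≤ (∫⁻ y, F y ∂ν) ^ p⁻¹ * (∫⁻ y, G y ∂ν) ^ q⁻¹ := by
  calc ν univ = ∫⁻ y, F y ^ p⁻¹ * G y ^ q⁻¹ ∂ν := by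
        rw [lintegral_congr_ae hFG, lintegral_one]
    _ ≤ (∫⁻ y, (F y ^ p⁻¹) ^ p ∂ν) ^ (1 / p) * (∫⁻ y, (G y ^ q⁻¹) ^ q ∂ν) ^ (1 / q) :=
        ENNReal.lintegral_mul_le_Lp_mul_Lq ν hpq (hF.pow_const _) (hG.pow_const _)
    _ = (∫⁻ y, F y ∂ν) ^ p⁻¹ * (∫⁻ y, G y ∂ν) ^ q⁻¹ := by
        simp only [ENNReal.rpow_inv_rpow hpq.ne_zero, ENNReal.rpow_inv_rpow hpq.symm.ne_zero,
          one_div]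

/-- A Muckenhoupt weight `W` of class `A_p` with values in `(0, ∞)`, together with its dual weight
`σ = W ^ (1 - q)` of class `A_q`. Duality and the `A_p` condition are both written symmetrically in
`(p, W)` and `(q, σ)`, the latter without averages. -/
structure IsMuckenhouptPair {X : Type*} [MetricSpace X] [MeasurableSpace X] (μ : Measure X)
    (p q : ℝ) (W σ : X → ℝ≥0∞) : Prop where
  holderConjugate : p.HolderConjugate q
  measurable_left : Measurable W
  measurable_right : Measurable σ
  rpow_mul_rpow (x : X) : W x ^ p⁻¹ * σ x ^ q⁻¹ = 1
  bound : ∃ C : ℝ≥0, ∀ (x : X) (r : ℝ), 0 < r →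
    (∫⁻ y in ball x r, W y ∂μ) ^ p⁻¹ * (∫⁻ y in ball x r, σ y ∂μ) ^ q⁻¹ ≤ C * μ (ball x r)

namespace IsMuckenhouptPair

variable {X : Type*} [MetricSpace X] [MeasurableSpace X] {μ : Measure X} {p q : ℝ}
  {W σ : X → ℝ≥0∞}

protected lemma symm (h : IsMuckenhouptPair μ p q W σ) : IsMuckenhouptPair μ q p σ W where
  holderConjugate := h.holderConjugate.symm
  measurable_left := h.measurable_right
  measurable_right := h.measurable_left
  rpow_mul_rpow x := by rw [mul_comm, h.rpow_mul_rpow]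
  bound := by simpa only [mul_comm (_ ^ q⁻¹)] using h.bound

lemma left_ne_zero (h : IsMuckenhouptPair μ p q W σ) (x : X) : W x ≠ 0 := fun h0 => by
  simpa [h0, ENNReal.zero_rpow_of_pos h.holderConjugate.inv_pos] using h.rpow_mul_rpow x

lemma right_eq_rpow (h : IsMuckenhouptPair μ p q W σ) (x : X) : σ x = W x ^ (1 - q) := by
  have hinv : σ x ^ q⁻¹ = (W x ^ p⁻¹)⁻¹ :=
    ENNReal.eq_inv_of_mul_eq_one_left (by rw [mul_comm, h.rpow_mul_rpow])
  have hq : 1 - q = -p⁻¹ * q := by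
    rw [neg_mul, inv_mul_eq_div, h.holderConjugate.symm.div_conj_eq_sub_one, neg_sub]
  rw [hq, ENNReal.rpow_mul, ENNReal.rpow_neg, ← hinv,
    ENNReal.rpow_inv_rpow h.holderConjugate.symm.ne_zero]

lemma left_ne_top (h : IsMuckenhouptPair μ p q W σ) (x : X) : W x ≠ ∞ := fun htop => by
  refine h.symm.left_ne_zero x ?_
  rw [h.right_eq_rpow, htop, ENNReal.top_rpow_of_neg (by linarith [h.holderConjugate.symm.lt])]

lemma left_mul_inv_mul_rpow (h : IsMuckenhouptPair μ p q W σ) (x : X) (c : ℝ≥0∞) :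
    W x * ((W x)⁻¹ * c) ^ q = σ x * c ^ q := by
  rw [ENNReal.mul_rpow_of_nonneg _ _ h.holderConjugate.symm.nonneg, ← mul_assoc, h.right_eq_rpow,
    ENNReal.inv_rpow, ← ENNReal.rpow_neg, sub_eq_add_neg,
    ENNReal.rpow_add _ _ (h.left_ne_zero x) (h.left_ne_top x), ENNReal.rpow_one]

lemma lintegral_ball_pos (h : IsMuckenhouptPair μ p q W σ) (hμ : IsDoubling μ) (x : X) {r : ℝ}
    (hr : 0 < r) : 0 < ∫⁻ y in ball x r, W y ∂μ := by
  rw [setLIntegral_pos_iff h.measurable_left,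
    eq_univ_of_forall (s := Function.support W) h.left_ne_zero, univ_inter]
  exact hμ.measure_ball_pos x hr

lemma lintegral_ball_lt_top (h : IsMuckenhouptPair μ p q W σ) (hμ : IsDoubling μ) (x : X) {r : ℝ}
    (hr : 0 < r) : ∫⁻ y in ball x r, W y ∂μ < ∞ := by
  obtain ⟨C, hC⟩ := h.bound
  have hfin := (hC x r hr).trans_lt
    (ENNReal.mul_lt_top ENNReal.coe_lt_top (hμ.measure_ball_lt_top x r))
  have hσ : (∫⁻ y in ball x r, σ y ∂μ) ^ q⁻¹ ≠ 0 := by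
    simp [(h.symm.lintegral_ball_pos hμ x hr).ne', h.holderConjugate.symm.pos.le]
  exact (ENNReal.rpow_lt_top_iff_of_pos h.holderConjugate.inv_pos).1
    (ENNReal.lt_top_of_mul_ne_top_left hfin.ne hσ)

lemma measure_le_lintegral_rpow_mul (h : IsMuckenhouptPair μ p q W σ) (s : Set X) :
    μ s ≤ (∫⁻ y in s, W y ∂μ) ^ p⁻¹ * (∫⁻ y in s, σ y ∂μ) ^ q⁻¹ := by
  simpa only [Measure.restrict_apply_univ] using measure_univ_le_lintegral_rpow_mul
    (ν := μ.restrict s) h.holderConjugate h.measurable_left.aemeasurable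
    h.measurable_right.aemeasurable (.of_forall h.rpow_mul_rpow)

variable [BorelSpace X]

lemma isDoubling_withDensity (h : IsMuckenhouptPair μ p q W σ) (hμ : IsDoubling μ) :
    IsDoubling (μ.withDensity W) := by
  have hp := h.holderConjugate.pos
  have hq := h.holderConjugate.symm.pos
  obtain ⟨C, hC⟩ := h.bound
  obtain ⟨D, -, hD⟩ := id hμ
  refine ⟨max 2 ((C * D) ^ p), lt_max_of_lt_left (by norm_num), fun x r hr => ?_⟩
  simp only [withDensity_apply _ measurableSet_ball]
  have hr2 : 0 < 2 * r := by positivity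
  refine ⟨h.lintegral_ball_pos hμ x hr2, ?_,
    ENNReal.mul_lt_top ENNReal.coe_lt_top (h.lintegral_ball_lt_top hμ x hr)⟩
  set S := (∫⁻ y in ball x (2 * r), σ y ∂μ) ^ q⁻¹
  have hS_ne_zero : S ≠ 0 := by
    simp [S, (h.symm.lintegral_ball_pos hμ x hr2).ne', hq.le]
  have hS_ne_top : S ≠ ∞ :=
    ENNReal.rpow_ne_top_of_nonneg (by positivity) (h.symm.lintegral_ball_lt_top hμ x hr2).ne
  have hS_mono : (∫⁻ y in ball x r, σ y ∂μ) ^ q⁻¹ ≤ S :=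
    ENNReal.rpow_le_rpow (lintegral_mono_set (ball_subset_ball (by linarith))) (inv_pos.2 hq).le
  have hroot : (∫⁻ y in ball x (2 * r), W y ∂μ) ^ p⁻¹ * S ≤
      C * D * (∫⁻ y in ball x r, W y ∂μ) ^ p⁻¹ * S :=
    calc (∫⁻ y in ball x (2 * r), W y ∂μ) ^ p⁻¹ * S
        ≤ C * μ (ball x (2 * r)) := hC x (2 * r) hr2
      _ ≤ C * (D * μ (ball x r)) := by gcongr; exact (hD x r hr).2.1
      _ ≤ C * (D * ((∫⁻ y in ball x r, W y ∂μ) ^ p⁻¹ * (∫⁻ y in ball x r, σ y ∂μ) ^ q⁻¹)) := by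
          gcongr; exact h.measure_le_lintegral_rpow_mul _
      _ ≤ C * (D * ((∫⁻ y in ball x r, W y ∂μ) ^ p⁻¹ * S)) := by gcongr
      _ = C * D * (∫⁻ y in ball x r, W y ∂μ) ^ p⁻¹ * S := by ring
  calc ∫⁻ y in ball x (2 * r), W y ∂μ
      ≤ (C * D * (∫⁻ y in ball x r, W y ∂μ) ^ p⁻¹) ^ p :=
        (ENNReal.rpow_inv_le_iff hp).1 ((ENNReal.mul_le_mul_iff_left hS_ne_zero hS_ne_top).1 hroot)
    _ = ↑((C * D) ^ p) * ∫⁻ y in ball x r, W y ∂μ := by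
        rw [ENNReal.mul_rpow_of_nonneg _ _ hp.le, ENNReal.rpow_inv_rpow hp.ne',
          ENNReal.coe_rpow_of_nonneg _ hp.le, ENNReal.coe_mul]
    _ ≤ _ := by gcongr; exact le_max_right _ _

lemma exists_lintegral_mul_maximal_withDensity_le (h : IsMuckenhouptPair μ p q W σ)
    (hμ : IsDoubling μ) {a : ℝ} (ha : 1 < a) :
    ∃ K : ℝ≥0, ∀ g : X → ℝ≥0∞, Measurable g →
      ∫⁻ x, W x * maximal (μ.withDensity W) g x ^ a ∂μ ≤ K * ∫⁻ x, W x * g x ^ a ∂μ := by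
  obtain ⟨K, hK⟩ := (h.isDoubling_withDensity hμ).exists_lintegral_maximal_rpow_le ha
  refine ⟨K, fun g hg => ?_⟩
  have hle := hK g hg
  rwa [lintegral_withDensity_eq_lintegral_mul _ h.measurable_left (hg.pow_const a),
    lintegral_withDensity_eq_lintegral_mul _ h.measurable_left
      ((measurable_maximal _ _).pow_const a)] at hle

/-! The pointwise domination of `maximal μ` by a composition of `maximal (μ.withDensity W)` and
`maximal (μ.withDensity σ)` reduces the weighted bound to the unweighted theorem for these two
doubling measures (Lerner). -/

lemma measure_mul_rpow_setLAverage_le (h : IsMuckenhouptPair μ p q W σ) (g : X → ℝ≥0∞) (z : X)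
    (r : ℝ) :
    μ (ball z r) * (⨍⁻ y in ball z r, g y ∂μ.withDensity σ) ^ (p - 1) ≤
      ∫⁻ y in ball z r, (W y)⁻¹ * maximal (μ.withDensity σ) g y ^ (p - 1) ∂μ.withDensity W := by
  have hp : 0 ≤ p - 1 := h.holderConjugate.sub_one_pos.le
  have hmeas : Measurable fun y => (W y)⁻¹ * maximal (μ.withDensity σ) g y ^ (p - 1) :=
    h.measurable_left.inv.mul ((measurable_maximal _ _).pow_const _)
  rw [setLIntegral_withDensity_eq_setLIntegral_mul _ h.measurable_left hmeas measurableSet_ball,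
    mul_comm, ← setLIntegral_const]
  refine setLIntegral_mono' measurableSet_ball fun y hy => ?_
  rw [Pi.mul_apply, ← mul_assoc, ENNReal.mul_inv_cancel (h.left_ne_zero y) (h.left_ne_top y),
    one_mul]
  exact ENNReal.rpow_le_rpow (setLAverage_le_maximal _ _ hy) hp

lemma exists_withDensity_mul_rpow_le (h : IsMuckenhouptPair μ p q W σ) :
    ∃ C : ℝ≥0, ∀ (x : X) (r : ℝ), 0 < r → μ.withDensity σ (ball x r) *
      μ.withDensity W (ball x r) ^ (q - 1) ≤ C * μ (ball x r) ^ q := by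
  obtain ⟨C, hC⟩ := h.bound
  have hq := h.holderConjugate.symm
  refine ⟨C ^ q, fun x r hr => ?_⟩
  rw [withDensity_apply _ measurableSet_ball, withDensity_apply _ measurableSet_ball,
    ENNReal.coe_rpow_of_nonneg _ hq.nonneg, ← ENNReal.mul_rpow_of_nonneg _ _ hq.nonneg]
  convert! ENNReal.rpow_le_rpow (hC x r hr) hq.nonneg using 1
  rw [ENNReal.mul_rpow_of_nonneg _ _ hq.nonneg, ENNReal.rpow_inv_rpow hq.ne_zero,
    ← ENNReal.rpow_mul, inv_mul_eq_div, hq.div_conj_eq_sub_one, mul_comm]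

lemma exists_maximal_mul_le (h : IsMuckenhouptPair μ p q W σ) (hμ : IsDoubling μ) :
    ∃ C : ℝ≥0, ∀ g : X → ℝ≥0∞, Measurable g → ∀ x,
      maximal μ (fun y => σ y * g y) x ≤ C * maximal (μ.withDensity W)
        (fun y => (W y)⁻¹ * maximal (μ.withDensity σ) g y ^ (p - 1)) x ^ (q - 1) := by
  obtain ⟨C, hC⟩ := h.exists_withDensity_mul_rpow_le
  have hq := h.holderConjugate.symm.sub_one_pos
  refine ⟨C, fun g hg x => maximal_le fun z r hx => ?_⟩
  have hr := pos_of_mem_ball hx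
  set B := ball z r
  have hB_ne_zero : μ B ≠ 0 := (hμ.measure_ball_pos z hr).ne'
  have hB_ne_top : μ B ≠ ∞ := (hμ.measure_ball_lt_top z r).ne
  set H := maximal (μ.withDensity W)
    (fun y => (W y)⁻¹ * maximal (μ.withDensity σ) g y ^ (p - 1)) x
  set A := ⨍⁻ y in B, g y ∂μ.withDensity σ
  have hσA : ∫⁻ y in B, σ y * g y ∂μ = μ.withDensity σ B * A := by
    rw [measure_mul_setLAverage _ ((h.symm.isDoubling_withDensity hμ).measure_ball_lt_top z r).ne]
    exact (setLIntegral_withDensity_eq_setLIntegral_mul _ h.measurable_right hg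
      measurableSet_ball).symm
  have hAH : μ B ^ (q - 1) * A ≤ (μ.withDensity W B * H) ^ (q - 1) := by
    have hexp : (p - 1) * (q - 1) = 1 := by linarith [h.holderConjugate.mul_eq_add]
    have hWH : μ B * A ^ (p - 1) ≤ μ.withDensity W B * H := by
      refine (h.measure_mul_rpow_setLAverage_le g z r).trans ?_
      rw [← measure_mul_setLAverage _ ((h.isDoubling_withDensity hμ).measure_ball_lt_top z r).ne]
      exact mul_le_mul_right (setLAverage_le_maximal _ _ hx) _
    simpa only [ENNReal.mul_rpow_of_nonneg _ _ hq.le, ← ENNReal.rpow_mul, hexp, ENNReal.rpow_one]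
      using ENNReal.rpow_le_rpow hWH hq.le
  have hcancel : μ B ^ (q - 1) ≠ 0 ∧ μ B ^ (q - 1) ≠ ∞ := by
    simp [hB_ne_zero, hB_ne_top]
  rw [setLAverage_eq, hσA]
  refine ENNReal.div_le_of_le_mul ((ENNReal.mul_le_mul_iff_right hcancel.1 hcancel.2).1 ?_)
  calc μ B ^ (q - 1) * (μ.withDensity σ B * A)
      = μ.withDensity σ B * (μ B ^ (q - 1) * A) := by ring
    _ ≤ μ.withDensity σ B * (μ.withDensity W B * H) ^ (q - 1) := by gcongr
    _ = μ.withDensity σ B * μ.withDensity W B ^ (q - 1) * H ^ (q - 1) := by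
        rw [ENNReal.mul_rpow_of_nonneg _ _ hq.le, mul_assoc]
    _ ≤ C * μ B ^ q * H ^ (q - 1) := by gcongr ?_ * _; exact hC z r hr
    _ = μ B ^ (q - 1) * (C * H ^ (q - 1) * μ B) := by
        rw [← mul_rpow_sub_one (sub_nonneg.1 hq.le) (μ B)]; ring

theorem exists_lintegral_maximal_le (h : IsMuckenhouptPair μ p q W σ) (hμ : IsDoubling μ) :
    ∃ K : ℝ≥0, ∀ f : X → ℝ≥0∞, Measurable f →
      ∫⁻ x, W x * maximal μ f x ^ p ∂μ ≤ K * ∫⁻ x, W x * f x ^ p ∂μ := by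
  have hpq := h.holderConjugate
  obtain ⟨C, hC⟩ := h.exists_maximal_mul_le hμ
  obtain ⟨K₁, hK₁⟩ := h.exists_lintegral_mul_maximal_withDensity_le hμ hpq.symm.lt
  obtain ⟨K₂, hK₂⟩ := h.symm.exists_lintegral_mul_maximal_withDensity_le hμ hpq.lt
  refine ⟨C ^ p * K₁ * K₂, fun f hf => ?_⟩
  let g : X → ℝ≥0∞ := fun y => (σ y)⁻¹ * f y
  have hg : Measurable g := h.measurable_right.inv.mul hf
  have hσg : (fun y => σ y * g y) = f := funext fun y =>
    ENNReal.mul_inv_cancel_left (h.symm.left_ne_zero y) (h.symm.left_ne_top y)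
  let G := maximal (μ.withDensity σ) g
  have hG : Measurable G := measurable_maximal _ _
  let H := maximal (μ.withDensity W) (fun y => (W y)⁻¹ * G y ^ (p - 1))
  have hH : Measurable H := measurable_maximal _ _
  have hdom (x : X) : maximal μ f x ^ p ≤ C ^ p * H x ^ q := by
    have hexp : (q - 1) * p = q := by linarith [hpq.mul_eq_add]
    have hle := ENNReal.rpow_le_rpow (hC g hg x) hpq.nonneg
    rwa [hσg, ENNReal.mul_rpow_of_nonneg _ _ hpq.nonneg, ← ENNReal.rpow_mul, hexp] at hle
  have hWG (x : X) : W x * ((W x)⁻¹ * G x ^ (p - 1)) ^ q = σ x * G x ^ p := by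
    have hexp : (p - 1) * q = p := by linarith [hpq.mul_eq_add]
    rw [h.left_mul_inv_mul_rpow, ← ENNReal.rpow_mul, hexp]
  have hHG : ∫⁻ x, W x * H x ^ q ∂μ ≤ K₁ * ∫⁻ x, σ x * G x ^ p ∂μ := by
    simpa only [hWG] using
      hK₁ (fun y => (W y)⁻¹ * G y ^ (p - 1)) (h.measurable_left.inv.mul (hG.pow_const _))
  have hGf : ∫⁻ x, σ x * G x ^ p ∂μ ≤ K₂ * ∫⁻ x, W x * f x ^ p ∂μ := by
    simpa only [g, h.symm.left_mul_inv_mul_rpow] using hK₂ g hg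
  calc ∫⁻ x, W x * maximal μ f x ^ p ∂μ
      ≤ ∫⁻ x, C ^ p * (W x * H x ^ q) ∂μ := by
        refine lintegral_mono fun x => ?_
        rw [mul_left_comm]
        exact mul_le_mul_right (hdom x) _
    _ = C ^ p * ∫⁻ x, W x * H x ^ q ∂μ :=
        lintegral_const_mul _ (h.measurable_left.mul (hH.pow_const q))
    _ ≤ C ^ p * (K₁ * (K₂ * ∫⁻ x, W x * f x ^ p ∂μ)) := by
        gcongr; exact hHG.trans (mul_le_mul_right hGf _)
    _ = ↑(C ^ p * K₁ * K₂) * ∫⁻ x, W x * f x ^ p ∂μ := by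
        rw [ENNReal.coe_mul, ENNReal.coe_mul, ENNReal.coe_rpow_of_nonneg _ hpq.nonneg]; ring

end IsMuckenhouptPair

/-! ### The Rubio de Francia algorithm -/

section RubioDeFrancia

variable {Y : Type*}

/-- The Rubio de Francia series `∑ cᵏ Tᵏ f`, a function on which `T` acts pointwise boundedly. -/
noncomputable def rubioDeFrancia (T : (Y → ℝ≥0∞) → Y → ℝ≥0∞) (c : ℝ≥0) (f : Y → ℝ≥0∞)
    (y : Y) : ℝ≥0∞ :=
  ∑' k : ℕ, ↑(c ^ k) * T^[k] f y

lemma le_rubioDeFrancia (T : (Y → ℝ≥0∞) → Y → ℝ≥0∞) (c : ℝ≥0) (f : Y → ℝ≥0∞) (y : Y) :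
    f y ≤ rubioDeFrancia T c f y := by
  simpa [rubioDeFrancia] using ENNReal.le_tsum (f := fun k : ℕ => (↑(c ^ k) : ℝ≥0∞) * T^[k] f y) 0

variable [MeasurableSpace Y] {ν : Measure Y}

lemma lintegral_sum_range_rpow_le {t : ℝ} (ht : 1 ≤ t) {f : ℕ → Y → ℝ≥0∞}
    (hf : ∀ k, Measurable (f k)) (n : ℕ) :
    (∫⁻ y, (∑ k ∈ Finset.range n, f k y) ^ t ∂ν) ^ t⁻¹ ≤
      ∑ k ∈ Finset.range n, (∫⁻ y, f k y ^ t ∂ν) ^ t⁻¹ := by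
  have ht0 : 0 < t := by linarith
  induction n with
  | zero => simp [ENNReal.zero_rpow_of_pos ht0, ENNReal.zero_rpow_of_pos (inv_pos.2 ht0)]
  | succ n ih =>
    simp only [Finset.sum_range_succ]
    have hadd := ENNReal.lintegral_Lp_add_le (μ := ν) (f := fun y => ∑ k ∈ Finset.range n, f k y)
      (Finset.measurable_fun_sum _ fun k _ => hf k).aemeasurable (hf n).aemeasurable ht
    simp only [one_div] at hadd
    exact hadd.trans (add_le_add_left ih _)

lemma lintegral_tsum_rpow_le {t : ℝ} (ht : 1 ≤ t) {f : ℕ → Y → ℝ≥0∞}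
    (hf : ∀ k, Measurable (f k)) :
    ∫⁻ y, (∑' k, f k y) ^ t ∂ν ≤ (∑' k, (∫⁻ y, f k y ^ t ∂ν) ^ t⁻¹) ^ t := by
  have ht0 : 0 < t := by linarith
  calc ∫⁻ y, (∑' k, f k y) ^ t ∂ν
      = ∫⁻ y, ⨆ n : ℕ, (∑ k ∈ Finset.range n, f k y) ^ t ∂ν := by
        refine lintegral_congr fun y => ?_
        rw [ENNReal.tsum_eq_iSup_nat]
        exact (ENNReal.orderIsoRpow t ht0).map_iSup _
    _ = ⨆ n : ℕ, ∫⁻ y, (∑ k ∈ Finset.range n, f k y) ^ t ∂ν :=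
        lintegral_iSup (fun n => (Finset.measurable_fun_sum _ fun k _ => hf k).pow_const t)
          fun m n hmn y => ENNReal.rpow_le_rpow
            (Finset.sum_le_sum_of_subset (Finset.range_mono hmn)) ht0.le
    _ ≤ (∑' k, (∫⁻ y, f k y ^ t ∂ν) ^ t⁻¹) ^ t := by
        refine iSup_le fun n => (ENNReal.rpow_inv_le_iff ht0).1 ?_
        exact (lintegral_sum_range_rpow_le ht hf n).trans (ENNReal.sum_le_tsum _)

/-- Countable sublinearity of an operator `T` on `[0, ∞]`-valued functions: `T` preserves
measurability and `T (∑ cₖ fₖ) ≤ ∑ cₖ T fₖ` for all finite constants `cₖ ≥ 0`. -/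
structure IsCountablySublinear (T : (Y → ℝ≥0∞) → Y → ℝ≥0∞) : Prop where
  measurable {f : Y → ℝ≥0∞} (hf : Measurable f) : Measurable (T f)
  tsum_le (c : ℕ → ℝ≥0) {f : ℕ → Y → ℝ≥0∞} (hf : ∀ k, Measurable (f k)) (y : Y) :
    T (fun y => ∑' k, c k * f k y) y ≤ ∑' k, c k * T (f k) y

namespace IsCountablySublinear

variable {S T : (Y → ℝ≥0∞) → Y → ℝ≥0∞}

protected lemma max (hS : IsCountablySublinear S) (hT : IsCountablySublinear T) :
    IsCountablySublinear fun f y => max (S f y) (T f y) where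
  measurable hf := (hS.measurable hf).max (hT.measurable hf)
  tsum_le c f hf y := max_le
    ((hS.tsum_le c hf y).trans (ENNReal.tsum_le_tsum fun _ => by gcongr; exact le_max_left _ _))
    ((hT.tsum_le c hf y).trans (ENNReal.tsum_le_tsum fun _ => by gcongr; exact le_max_right _ _))

variable {f : Y → ℝ≥0∞}

lemma measurable_iterate (hT : IsCountablySublinear T) (hf : Measurable f) (k : ℕ) :
    Measurable (T^[k] f) := by
  induction k with
  | zero => exact hf
  | succ k ih => rw [Function.iterate_succ_apply']; exact hT.measurable ih

lemma measurable_rubioDeFrancia (hT : IsCountablySublinear T) (c : ℝ≥0) (hf : Measurable f) :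
    Measurable (rubioDeFrancia T c f) :=
  Measurable.tsum fun k => (hT.measurable_iterate hf k).const_mul _

lemma apply_rubioDeFrancia_le (hT : IsCountablySublinear T) {c : ℝ≥0} (hc : c ≠ 0)
    (hf : Measurable f) (y : Y) :
    T (rubioDeFrancia T c f) y ≤ ↑(c⁻¹) * rubioDeFrancia T c f y := by
  calc T (rubioDeFrancia T c f) y
      ≤ ∑' k : ℕ, ↑(c ^ k) * T (T^[k] f) y :=
        hT.tsum_le (fun k => c ^ k) (hT.measurable_iterate hf) y
    _ = ↑(c⁻¹) * ∑' k : ℕ, ↑(c ^ (k + 1)) * T^[k + 1] f y := by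
        rw [← ENNReal.tsum_mul_left]
        refine tsum_congr fun k => ?_
        rw [Function.iterate_succ_apply', ← mul_assoc, ← ENNReal.coe_mul, pow_succ',
          inv_mul_cancel_left₀ hc]
    _ ≤ ↑(c⁻¹) * rubioDeFrancia T c f y := by
        gcongr
        exact ENNReal.tsum_comp_le_tsum_of_injective (add_left_injective 1)
          fun k => (↑(c ^ k) : ℝ≥0∞) * T^[k] f y

variable {r : ℝ} {K : ℝ≥0}

lemma lintegral_iterate_rpow_le (hT : IsCountablySublinear T)
    (hK : ∀ g, Measurable g → ∫⁻ y, T g y ^ r ∂ν ≤ K * ∫⁻ y, g y ^ r ∂ν) (hf : Measurable f)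
    (k : ℕ) : ∫⁻ y, T^[k] f y ^ r ∂ν ≤ K ^ k * ∫⁻ y, f y ^ r ∂ν := by
  induction k with
  | zero => simp
  | succ k ih =>
    rw [Function.iterate_succ_apply', pow_succ', mul_assoc]
    exact (hK _ (hT.measurable_iterate hf k)).trans (mul_le_mul_right ih _)

lemma lintegral_rubioDeFrancia_rpow_ne_top (hT : IsCountablySublinear T) (hr : 1 ≤ r)
    (hK : ∀ g, Measurable g → ∫⁻ y, T g y ^ r ∂ν ≤ K * ∫⁻ y, g y ^ r ∂ν) {c : ℝ≥0}
    (hc : c * K ^ r⁻¹ < 1) (hf : Measurable f) (hfr : ∫⁻ y, f y ^ r ∂ν ≠ ∞) :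
    ∫⁻ y, rubioDeFrancia T c f y ^ r ∂ν ≠ ∞ := by
  have hr0 : 0 < r := by linarith
  have hmeas (k : ℕ) := hT.measurable_iterate hf k
  have hterm (k : ℕ) : (∫⁻ y, (↑(c ^ k) * T^[k] f y) ^ r ∂ν) ^ r⁻¹ ≤
      ↑(c * K ^ r⁻¹) ^ k * (∫⁻ y, f y ^ r ∂ν) ^ r⁻¹ := by
    simp only [ENNReal.mul_rpow_of_nonneg _ _ hr0.le]
    rw [lintegral_const_mul _ ((hmeas k).pow_const r),
      ENNReal.mul_rpow_of_nonneg _ _ (inv_pos.2 hr0).le, ENNReal.rpow_rpow_inv hr0.ne']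
    calc (↑(c ^ k) : ℝ≥0∞) * (∫⁻ y, T^[k] f y ^ r ∂ν) ^ r⁻¹
        ≤ ↑(c ^ k) * (K ^ k * ∫⁻ y, f y ^ r ∂ν) ^ r⁻¹ := by
          gcongr; exact hT.lintegral_iterate_rpow_le hK hf k
      _ = ↑(c * K ^ r⁻¹) ^ k * (∫⁻ y, f y ^ r ∂ν) ^ r⁻¹ := by
          rw [ENNReal.mul_rpow_of_nonneg _ _ (inv_pos.2 hr0).le, ENNReal.coe_mul, mul_pow,
            ENNReal.coe_rpow_of_nonneg _ (inv_pos.2 hr0).le, ENNReal.coe_pow, mul_assoc,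
            ← ENNReal.rpow_natCast_mul, ← ENNReal.rpow_mul_natCast, mul_comm (k : ℝ)]
  refine ne_top_of_le_ne_top (ENNReal.rpow_ne_top_of_nonneg hr0.le ?_)
    (lintegral_tsum_rpow_le hr fun k => (hmeas k).const_mul _)
  refine ne_top_of_le_ne_top ?_ (ENNReal.tsum_le_tsum hterm)
  rw [ENNReal.tsum_mul_right, ENNReal.tsum_geometric]
  refine ENNReal.mul_ne_top (ENNReal.inv_ne_top.2 (tsub_pos_of_lt ?_).ne') (by finiteness)
  exact_mod_cast hc

lemma exists_majorant (hT : IsCountablySublinear T) (hr : 1 ≤ r)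
    (hK : ∀ g, Measurable g → ∫⁻ y, T g y ^ r ∂ν ≤ K * ∫⁻ y, g y ^ r ∂ν)
    (hf : Measurable f) (hfr : ∫⁻ y, f y ^ r ∂ν ≠ ∞) :
    ∃ η : Y → ℝ≥0∞, Measurable η ∧ (∀ y, f y ≤ η y) ∧ ∫⁻ y, η y ^ r ∂ν ≠ ∞ ∧
      ∃ C : ℝ≥0, ∀ y, T η y ≤ C * η y := by
  let c : ℝ≥0 := (K ^ r⁻¹ + 1)⁻¹
  have hc : c * K ^ r⁻¹ < 1 := by
    rw [inv_mul_lt_iff₀ (by positivity), mul_one]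
    exact lt_add_one _
  exact ⟨rubioDeFrancia T c f, hT.measurable_rubioDeFrancia c hf, le_rubioDeFrancia T c f,
    hT.lintegral_rubioDeFrancia_rpow_ne_top hr hK hc hf hfr, c⁻¹,
    hT.apply_rubioDeFrancia_le (by positivity) hf⟩

end IsCountablySublinear

end RubioDeFrancia

/-! ### Jones' factorization of Muckenhoupt weights -/

section WeightedMaximal

variable {X : Type*} [MetricSpace X] [MeasurableSpace X] {μ : Measure X} {a : X → ℝ≥0∞} {t : ℝ}

/-- The operator `f ↦ (a⁻¹ M (a f ^ t)) ^ (1 / t)`. A function `η` on which it is pointwise bounded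
yields the `A_1` weight `a η ^ t`. -/
noncomputable def weightedMaximal (μ : Measure X) (a : X → ℝ≥0∞) (t : ℝ) (f : X → ℝ≥0∞)
    (x : X) : ℝ≥0∞ :=
  ((a x)⁻¹ * maximal μ (fun y => a y * f y ^ t) x) ^ t⁻¹

lemma weightedMaximal_le_iff (ht : 0 < t) (ha0 : ∀ x, a x ≠ 0) (hat : ∀ x, a x ≠ ∞)
    {f : X → ℝ≥0∞} {x : X} {c : ℝ≥0∞} :
    weightedMaximal μ a t f x ≤ c ↔ maximal μ (fun y => a y * f y ^ t) x ≤ a x * c ^ t := by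
  rw [weightedMaximal, ENNReal.rpow_inv_le_iff ht, ← ENNReal.div_eq_inv_mul,
    ENNReal.div_le_iff (ha0 x) (hat x), mul_comm]

lemma setLAverage_mul_rpow_le (ht : 0 < t) (ha0 : ∀ x, a x ≠ 0)
    (hat : ∀ x, a x ≠ ∞) (f : X → ℝ≥0∞) {x z : X} {r : ℝ} (hx : x ∈ ball z r) :
    ⨍⁻ y in ball z r, a y * f y ^ t ∂μ ≤ a x * weightedMaximal μ a t f x ^ t :=
  (setLAverage_le_maximal μ _ hx).trans ((weightedMaximal_le_iff ht ha0 hat).1 le_rfl)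

lemma isCountablySublinear_weightedMaximal [BorelSpace X] (ht : 1 ≤ t) (ha : Measurable a)
    (ha0 : ∀ x, a x ≠ 0) (hat : ∀ x, a x ≠ ∞) :
    IsCountablySublinear (weightedMaximal μ a t) where
  measurable _ := (ha.inv.mul (measurable_maximal μ _)).pow_const _
  tsum_le c f hf x := by
    have ht0 : 0 < t := by linarith
    refine (weightedMaximal_le_iff ht0 ha0 hat).2 (maximal_le fun z r hx => ?_)
    have hroot (u v : ℝ≥0∞) : (u ^ t⁻¹ * v) ^ t = u * v ^ t := by
      rw [ENNReal.mul_rpow_of_nonneg _ _ ht0.le, ENNReal.rpow_inv_rpow ht0.ne']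
    have hterm (k : ℕ) : (⨍⁻ y in ball z r, (a y ^ t⁻¹ * (c k * f k y)) ^ t ∂μ) ^ t⁻¹ ≤
        a x ^ t⁻¹ * (c k * weightedMaximal μ a t (f k) x) := by
      rw [ENNReal.rpow_inv_le_iff ht0, hroot, ENNReal.mul_rpow_of_nonneg _ _ ht0.le]
      simp only [hroot, ENNReal.mul_rpow_of_nonneg _ _ ht0.le, mul_left_comm _ ((c k : ℝ≥0∞) ^ t)]
      rw [laverage_const_mul (f := fun y => a y * f k y ^ t)
        (ha.mul ((hf k).pow_const t)).aemeasurable]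
      exact mul_le_mul_right (setLAverage_mul_rpow_le ht0 ha0 hat (f k) hx) _
    calc ⨍⁻ y in ball z r, a y * (∑' k, c k * f k y) ^ t ∂μ
        = ⨍⁻ y in ball z r, (∑' k, a y ^ t⁻¹ * (c k * f k y)) ^ t ∂μ := by
          simp only [ENNReal.tsum_mul_left, hroot]
      _ ≤ (∑' k, (⨍⁻ y in ball z r, (a y ^ t⁻¹ * (c k * f k y)) ^ t ∂μ) ^ t⁻¹) ^ t :=
          lintegral_tsum_rpow_le ht fun k => (ha.pow_const _).mul ((hf k).const_mul _)
      _ ≤ (∑' k, a x ^ t⁻¹ * (c k * weightedMaximal μ a t (f k) x)) ^ t :=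
          ENNReal.rpow_le_rpow (ENNReal.tsum_le_tsum hterm) ht0.le
      _ = a x * (∑' k, c k * weightedMaximal μ a t (f k) x) ^ t := by
          rw [ENNReal.tsum_mul_left, hroot]

/-- A measurable, positive, almost everywhere finite weight of class `A_1`. The `A_1` condition is
imposed as `M v ≤ C v` at every point, rather than through essential infima over balls. -/
structure IsPosMuckenhouptOne (μ : Measure X) (v : X → ℝ≥0∞) : Prop where
  measurable : Measurable v
  ne_zero (x : X) : v x ≠ 0
  ae_ne_top : ∀ᵐ x ∂μ, v x ≠ ∞
  bound : ∃ C : ℝ≥0, ∀ x, maximal μ v x ≤ C * v x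

lemma isPosMuckenhouptOne_of_weightedMaximal_le (ht : 0 < t) (ha : Measurable a)
    (ha0 : ∀ x, a x ≠ 0) (hat : ∀ x, a x ≠ ∞) {η : X → ℝ≥0∞} (hη : Measurable η)
    (hη0 : ∀ x, η x ≠ 0) (hηt : ∀ᵐ x ∂μ, η x ≠ ∞) {C : ℝ≥0}
    (hC : ∀ x, weightedMaximal μ a t η x ≤ C * η x) :
    IsPosMuckenhouptOne μ fun x => a x * η x ^ t where
  measurable := ha.mul (hη.pow_const t)
  ne_zero x := mul_ne_zero (ha0 x) (by simp [ENNReal.rpow_eq_zero_iff, hη0 x, ht.le])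
  ae_ne_top := hηt.mono fun x hx =>
    ENNReal.mul_ne_top (hat x) (ENNReal.rpow_ne_top_of_nonneg ht.le hx)
  bound := by
    refine ⟨C ^ t, fun x => ((weightedMaximal_le_iff ht ha0 hat).1 (hC x)).trans_eq ?_⟩
    rw [ENNReal.mul_rpow_of_nonneg _ _ ht.le, ENNReal.coe_rpow_of_nonneg _ ht.le, mul_left_comm]

end WeightedMaximal

namespace IsMuckenhouptPair

variable {X : Type*} [MetricSpace X] [MeasurableSpace X] {μ : Measure X} {p q : ℝ}
  {W σ : X → ℝ≥0∞}

lemma left_rpow_ne_zero (h : IsMuckenhouptPair μ p q W σ) (x : X) : W x ^ p⁻¹ ≠ 0 := fun h0 => by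
  simpa [h0] using h.rpow_mul_rpow x

lemma left_rpow_ne_top (h : IsMuckenhouptPair μ p q W σ) (x : X) : W x ^ p⁻¹ ≠ ∞ :=
  ENNReal.rpow_ne_top_of_nonneg h.holderConjugate.inv_pos.le (h.left_ne_top x)

variable [BorelSpace X]

lemma exists_lintegral_weightedMaximal_rpow_le (h : IsMuckenhouptPair μ p q W σ)
    (hμ : IsDoubling μ) : ∃ K : ℝ≥0, ∀ f : X → ℝ≥0∞, Measurable f →
      ∫⁻ x, weightedMaximal μ (fun y => σ y ^ q⁻¹) q f x ^ (q * p) ∂μ ≤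
        K * ∫⁻ x, f x ^ (q * p) ∂μ := by
  have hp := h.holderConjugate
  obtain ⟨K, hK⟩ := h.exists_lintegral_maximal_le hμ
  refine ⟨K, fun f hf => ?_⟩
  have hroot (x : X) (c : ℝ≥0∞) : W x * c ^ p = (W x ^ p⁻¹ * c) ^ p := by
    rw [ENNReal.mul_rpow_of_nonneg _ _ hp.nonneg, ENNReal.rpow_inv_rpow hp.ne_zero]
  have hmax (x : X) : weightedMaximal μ (fun y => σ y ^ q⁻¹) q f x ^ (q * p) =
      W x * maximal μ (fun y => σ y ^ q⁻¹ * f y ^ q) x ^ p := by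
    rw [hroot, ENNReal.eq_inv_of_mul_eq_one_left (h.rpow_mul_rpow x), ENNReal.rpow_mul,
      weightedMaximal, ENNReal.rpow_inv_rpow hp.symm.ne_zero]
  have hf_pow (x : X) : W x * (σ x ^ q⁻¹ * f x ^ q) ^ p = f x ^ (q * p) := by
    rw [hroot, ← mul_assoc, h.rpow_mul_rpow, one_mul, ENNReal.rpow_mul]
  simpa only [hmax, hf_pow] using
    hK (fun y => σ y ^ q⁻¹ * f y ^ q) ((h.measurable_right.pow_const q⁻¹).mul (hf.pow_const q))

lemma isCountablySublinear_weightedMaximal (h : IsMuckenhouptPair μ p q W σ) :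
    IsCountablySublinear (weightedMaximal μ (fun y => W y ^ p⁻¹) p) :=
  JonesFactorization.isCountablySublinear_weightedMaximal h.holderConjugate.lt.le
    (h.measurable_left.pow_const _) h.left_rpow_ne_zero h.left_rpow_ne_top

lemma exists_common_majorant (h : IsMuckenhouptPair μ p q W σ) (hμ : IsDoubling μ) :
    ∃ η : X → ℝ≥0∞, Measurable η ∧ (∀ x, η x ≠ 0) ∧ (∀ᵐ x ∂μ, η x ≠ ∞) ∧ ∃ C : ℝ≥0,
      (∀ x, weightedMaximal μ (fun y => W y ^ p⁻¹) p η x ≤ C * η x) ∧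
        ∀ x, weightedMaximal μ (fun y => σ y ^ q⁻¹) q η x ≤ C * η x := by
  have := hμ.sigmaFinite
  have hpq := h.holderConjugate
  have hr : 1 ≤ p * q := (one_lt_mul_of_lt_of_le hpq.lt hpq.symm.lt.le).le
  have hr0 : 0 < p * q := by linarith
  obtain ⟨K₁, hK₁⟩ := h.symm.exists_lintegral_weightedMaximal_rpow_le hμ
  obtain ⟨K₂, hK₂⟩ := h.exists_lintegral_weightedMaximal_rpow_le hμ
  rw [mul_comm q p] at hK₂
  have hT := h.isCountablySublinear_weightedMaximal.max h.symm.isCountablySublinear_weightedMaximal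
  have hTK (f : X → ℝ≥0∞) (hf : Measurable f) :
      ∫⁻ x, max (weightedMaximal μ (fun y => W y ^ p⁻¹) p f x)
        (weightedMaximal μ (fun y => σ y ^ q⁻¹) q f x) ^ (p * q) ∂μ ≤
        ↑(K₁ + K₂) * ∫⁻ x, f x ^ (p * q) ∂μ := by
    rw [ENNReal.coe_add, add_mul]
    refine le_trans ?_ (add_le_add (hK₁ f hf) (hK₂ f hf))
    rw [← lintegral_add_left
      ((h.isCountablySublinear_weightedMaximal.measurable hf).pow_const _)]
    refine lintegral_mono fun x => ?_
    rw [(ENNReal.monotone_rpow_of_nonneg hr0.le).map_max]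
    exact max_le_add_of_nonneg zero_le zero_le
  obtain ⟨g, hg_pos, hg, hg_int⟩ := exists_pos_lintegral_lt_of_sigmaFinite μ (ε := 1) one_ne_zero
  obtain ⟨η, hη, hgη, hη_int, C, hC⟩ := hT.exists_majorant hr hTK
    (f := fun x => (g x : ℝ≥0∞) ^ (p * q)⁻¹) (hg.coe_nnreal_ennreal.pow_const _)
    (by simpa only [ENNReal.rpow_inv_rpow hr0.ne'] using (hg_int.trans ENNReal.one_lt_top).ne)
  refine ⟨η, hη, fun x => ?_, ?_, C, fun x => (le_max_left _ _).trans (hC x),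
    fun x => (le_max_right _ _).trans (hC x)⟩
  · exact ((ENNReal.rpow_pos (by exact_mod_cast hg_pos x) ENNReal.coe_ne_top).trans_le (hgη x)).ne'
  · filter_upwards [ae_lt_top (hη.pow_const _) hη_int] with x hx
    exact ((ENNReal.rpow_lt_top_iff_of_pos hr0).1 hx).ne

theorem exists_factorization (h : IsMuckenhouptPair μ p q W σ) (hμ : IsDoubling μ) :
    ∃ v₁ v₂ : X → ℝ≥0∞, IsPosMuckenhouptOne μ v₁ ∧ IsPosMuckenhouptOne μ v₂ ∧
      ∀ᵐ x ∂μ, W x = v₁ x * v₂ x ^ (1 - p) := by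
  have hpq := h.holderConjugate
  obtain ⟨η, hη, hη0, hηt, C, hC₁, hC₂⟩ := h.exists_common_majorant hμ
  refine ⟨fun x => W x ^ p⁻¹ * η x ^ p, fun x => σ x ^ q⁻¹ * η x ^ q,
    isPosMuckenhouptOne_of_weightedMaximal_le hpq.pos (h.measurable_left.pow_const _)
      h.left_rpow_ne_zero h.left_rpow_ne_top hη hη0 hηt hC₁,
    isPosMuckenhouptOne_of_weightedMaximal_le hpq.symm.pos (h.measurable_right.pow_const _)
      h.symm.left_rpow_ne_zero h.symm.left_rpow_ne_top hη hη0 hηt hC₂, ?_⟩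
  filter_upwards [hηt] with x hx
  have hσ : (σ x ^ q⁻¹) ^ (1 - p) = W x ^ q⁻¹ := by
    rw [← ENNReal.rpow_mul, mul_comm, ENNReal.rpow_mul, ← h.symm.right_eq_rpow]
  have hη_exp : p + q * (1 - p) = 0 := by linarith [hpq.mul_eq_add]
  symm
  calc W x ^ p⁻¹ * η x ^ p * (σ x ^ q⁻¹ * η x ^ q) ^ (1 - p)
      = W x ^ p⁻¹ * η x ^ p * (W x ^ q⁻¹ * η x ^ (q * (1 - p))) := by
        rw [ENNReal.mul_rpow_of_ne_top (h.symm.left_rpow_ne_top x)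
          (ENNReal.rpow_ne_top_of_nonneg hpq.symm.nonneg hx), hσ, ← ENNReal.rpow_mul]
    _ = W x ^ (p⁻¹ + q⁻¹) * η x ^ (p + q * (1 - p)) := by
        rw [ENNReal.rpow_add _ _ (h.left_ne_zero x) (h.left_ne_top x),
          ENNReal.rpow_add _ _ (hη0 x) hx, mul_mul_mul_comm]
    _ = W x := by
        rw [hpq.inv_add_inv_eq_one, hη_exp, ENNReal.rpow_one, ENNReal.rpow_zero, mul_one]

end IsMuckenhouptPair

/-! ### Powers of `A_1` weights -/

section Average

variable {Y : Type*} [MeasurableSpace Y] {ν : Measure Y}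

lemma ofReal_toReal_ae_eq {f : Y → ℝ≥0∞} (hf : ∀ᵐ y ∂ν, f y ≠ ∞) :
    (fun y => ENNReal.ofReal (f y).toReal) =ᵐ[ν] f :=
  hf.mono fun _ => ENNReal.ofReal_toReal

lemma laverage_rpow_inv_le {v : Y → ℝ≥0∞} (hv : AEMeasurable v ν) {s : ℝ} (hs : 1 ≤ s) :
    ⨍⁻ y, v y ^ s⁻¹ ∂ν ≤ (⨍⁻ y, v y ∂ν) ^ s⁻¹ := by
  rcases hs.eq_or_lt with rfl | hs
  · simp
  have hconj := Real.HolderConjugate.conjExponent hs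
  calc ⨍⁻ y, v y ^ s⁻¹ ∂ν
      ≤ (⨍⁻ y, (v y ^ s⁻¹) ^ s ∂ν) ^ (1 / s) *
          (⨍⁻ _, 1 ^ s.conjExponent ∂ν) ^ (1 / s.conjExponent) := by
        simpa only [Pi.mul_apply, mul_one, laverage_eq'] using
          ENNReal.lintegral_mul_le_Lp_mul_Lq _ hconj ((hv.pow_const s⁻¹).smul_measure (ν univ)⁻¹)
            (aemeasurable_const (b := (1 : ℝ≥0∞)))
    _ ≤ (⨍⁻ y, v y ∂ν) ^ s⁻¹ * 1 := by
        simp only [ENNReal.rpow_inv_rpow hconj.ne_zero, one_div]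
        gcongr
        refine ENNReal.rpow_le_one (laverage_le_of_ae_le (.of_forall fun _ => ?_))
          hconj.symm.inv_pos.le
        rw [ENNReal.one_rpow]
    _ = _ := mul_one _

lemma le_mul_essInf {f : Y → ℝ≥0∞} {A : ℝ≥0∞} {C : ℝ≥0} (hC : C ≠ 0)
    (h : ∀ᵐ y ∂ν, A ≤ C * f y) : A ≤ C * essInf f ν := by
  rw [mul_comm, ← ENNReal.div_le_iff (by simpa using hC) ENNReal.coe_ne_top]
  refine le_essInf_of_ae_le _ (h.mono fun y hy => ?_)
  rwa [ENNReal.div_le_iff (by simpa using hC) ENNReal.coe_ne_top, mul_comm]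

variable [IsFiniteMeasure ν] [NeZero ν]

lemma le_laverage_of_ae_le {f : Y → ℝ≥0∞} {c : ℝ≥0∞} (h : ∀ᵐ y ∂ν, c ≤ f y) :
    c ≤ ⨍⁻ y, f y ∂ν :=
  (laverage_const ν c).symm.trans_le (laverage_mono_ae h)

lemma laverage_ne_zero {f : Y → ℝ≥0∞} (hf : AEMeasurable f ν) (h : ∀ᵐ y ∂ν, f y ≠ 0) :
    ⨍⁻ y, f y ∂ν ≠ 0 := by
  rw [laverage_eq]
  refine (ENNReal.div_pos (fun hzero => ?_) (measure_ne_top ν univ)).ne'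
  obtain ⟨y, hy, hy'⟩ := (h.and ((lintegral_eq_zero_iff' hf).1 hzero)).exists
  exact hy hy'

lemma rpow_one_sub_laverage_le {v : Y → ℝ≥0∞} (hv : AEMeasurable v ν) (h0 : ∀ᵐ y ∂ν, v y ≠ 0)
    (htop : ∀ᵐ y ∂ν, v y ≠ ∞) {p : ℝ} (hp : 1 < p) :
    (⨍⁻ y, v y ∂ν) ^ (1 - p) ≤ ⨍⁻ y, v y ^ (1 - p) ∂ν := by
  have hconj := Real.HolderConjugate.conjExponent hp
  have hexp : (1 - p) * p⁻¹ + p.conjExponent⁻¹ = 0 := by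
    rw [sub_mul, one_mul, mul_inv_cancel₀ hconj.ne_zero, sub_add_eq_add_sub,
      hconj.inv_add_inv_eq_one, sub_self]
  have hcancel : ∀ᵐ y ∂ν, (v y ^ (1 - p)) ^ p⁻¹ * v y ^ p.conjExponent⁻¹ = 1 := by
    filter_upwards [h0, htop] with y hy0 hyt
    rw [← ENNReal.rpow_mul, ← ENNReal.rpow_add _ _ hy0 hyt, hexp, ENNReal.rpow_zero]
  have hHolder := measure_univ_le_lintegral_rpow_mul (ν := (ν univ)⁻¹ • ν) hconj
    ((hv.pow_const (1 - p)).smul_measure _) (hv.smul_measure _)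
    (Measure.ae_smul_measure hcancel _)
  have hone : 1 ≤ (⨍⁻ y, v y ^ (1 - p) ∂ν) * (⨍⁻ y, v y ∂ν) ^ (p - 1) := by
    rw [Measure.smul_apply, smul_eq_mul, ENNReal.inv_mul_cancel
      (Measure.measure_univ_ne_zero.2 (NeZero.ne ν)) (measure_ne_top ν univ)] at hHolder
    simpa only [laverage_eq', ENNReal.one_rpow, ENNReal.mul_rpow_of_nonneg _ _ hconj.nonneg,
      ENNReal.rpow_inv_rpow hconj.ne_zero, ← ENNReal.rpow_mul, inv_mul_eq_div,
      hconj.div_conj_eq_sub_one] using ENNReal.rpow_le_rpow hHolder hconj.nonneg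
  calc (⨍⁻ y, v y ∂ν) ^ (1 - p) = 1 / (⨍⁻ y, v y ∂ν) ^ (p - 1) := by
        rw [← neg_sub p 1, ENNReal.rpow_neg, one_div]
    _ ≤ ⨍⁻ y, v y ^ (1 - p) ∂ν := ENNReal.div_le_of_le_mul hone

end Average

section Weight

variable {X : Type*} [MetricSpace X] [MeasurableSpace X] {μ : Measure X}

lemma IsDoubling.isFiniteMeasure_restrict_ball (hμ : IsDoubling μ) (x : X) (r : ℝ) :
    IsFiniteMeasure (μ.restrict (ball x r)) :=
  isFiniteMeasure_restrict.2 (hμ.measure_ball_lt_top x r).ne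

lemma IsDoubling.neZero_restrict_ball (hμ : IsDoubling μ) (x : X) {r : ℝ} (hr : 0 < r) :
    NeZero (μ.restrict (ball x r)) :=
  ⟨Measure.restrict_eq_zero.not.2 (hμ.measure_ball_pos x hr).ne'⟩

lemma isWeight_of_setLAverage_lt_top (hμ : IsDoubling μ) {w : X → ℝ}
    (hw : AEStronglyMeasurable w μ) (h0 : 0 ≤ᵐ[μ] w)
    (h : ∀ x, ∃ r > 0, ⨍⁻ y in ball x r, ENNReal.ofReal (w y) ∂μ < ∞) : IsWeight μ w := by
  refine ⟨h0, fun x => ?_⟩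
  obtain ⟨r, hr, hfin⟩ := h x
  refine ⟨ball x r, ball_mem_nhds x hr, hw.restrict, ?_⟩
  rw [hasFiniteIntegral_iff_ofReal (ae_restrict_of_ae h0),
    ← measure_mul_setLAverage _ (hμ.measure_ball_lt_top x r).ne]
  exact ENNReal.mul_lt_top (hμ.measure_ball_lt_top x r) hfin

lemma isWeight_toReal (hμ : IsDoubling μ) {F : X → ℝ≥0∞} (hF : Measurable F)
    (htop : ∀ᵐ x ∂μ, F x ≠ ∞) (h : ∀ x, ∃ r > 0, ⨍⁻ y in ball x r, F y ∂μ < ∞) :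
    IsWeight μ fun x => (F x).toReal := by
  refine isWeight_of_setLAverage_lt_top hμ hF.ennreal_toReal.aestronglyMeasurable
    (.of_forall fun _ => ENNReal.toReal_nonneg) fun x => ?_
  simpa only [laverage_congr (ae_restrict_of_ae (ofReal_toReal_ae_eq htop))] using h x

end Weight

namespace IsPosMuckenhouptOne

variable {X : Type*} [MetricSpace X] [MeasurableSpace X] {μ : Measure X} {v : X → ℝ≥0∞}

lemma exists_setLAverage_rpow_le (hv : IsPosMuckenhouptOne μ v) {t : ℝ} (ht : 0 ≤ t) :
    ∃ C : ℝ≥0, C ≠ 0 ∧ ∀ x r, ∀ y ∈ ball x r, (⨍⁻ z in ball x r, v z ∂μ) ^ t ≤ C * v y ^ t := by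
  obtain ⟨C, hC⟩ := hv.bound
  refine ⟨(C + 1) ^ t, (NNReal.rpow_pos (by positivity)).ne', fun x r y hy => ?_⟩
  rw [ENNReal.coe_rpow_of_nonneg _ ht, ← ENNReal.mul_rpow_of_nonneg _ _ ht]
  refine ENNReal.rpow_le_rpow ((setLAverage_le_maximal μ v hy).trans ((hC y).trans ?_)) ht
  gcongr
  exact le_self_add

lemma ae_rpow_ne_top (hv : IsPosMuckenhouptOne μ v) {t : ℝ} (ht : 0 ≤ t) :
    ∀ᵐ x ∂μ, v x ^ t ≠ ∞ :=
  hv.ae_ne_top.mono fun _ => ENNReal.rpow_ne_top_of_nonneg ht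

lemma rpow_one_sub_ne_top (hv : IsPosMuckenhouptOne μ v) {p : ℝ} (hp : 1 ≤ p) (x : X) :
    v x ^ (1 - p) ≠ ∞ := by
  simp [ENNReal.rpow_eq_top_iff, hv.ne_zero x, hp]

lemma exists_rpow_one_sub_le (hv : IsPosMuckenhouptOne μ v) {p : ℝ} (hp : 1 ≤ p) :
    ∃ C : ℝ≥0, ∀ x r, ∀ y ∈ ball x r,
      v y ^ (1 - p) ≤ C * (⨍⁻ z in ball x r, v z ∂μ) ^ (1 - p) := by
  obtain ⟨C, hC0, hC⟩ := hv.exists_setLAverage_rpow_le (sub_nonneg.2 hp)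
  refine ⟨C, fun x r y hy => ?_⟩
  rw [← neg_sub p 1, ENNReal.rpow_neg, ENNReal.rpow_neg, ← div_eq_mul_inv,
    ← ENNReal.inv_div (.inl ENNReal.coe_ne_top) (.inl (by simpa using hC0)), ENNReal.inv_le_inv]
  exact ENNReal.div_le_of_le_mul' (hC x r y hy)

variable [BorelSpace X]

lemma setLAverage_ne_top (hv : IsPosMuckenhouptOne μ v) (hμ : IsDoubling μ) (x : X) {r : ℝ}
    (hr : 0 < r) : ⨍⁻ z in ball x r, v z ∂μ ≠ ∞ := by
  have := hμ.neZero_restrict_ball x hr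
  obtain ⟨C, hC⟩ := hv.bound
  obtain ⟨y, hyt, hy⟩ := ((ae_restrict_of_ae (s := ball x r) hv.ae_ne_top).and
    (ae_restrict_mem measurableSet_ball)).exists
  exact ne_top_of_le_ne_top (ENNReal.mul_ne_top ENNReal.coe_ne_top hyt)
    ((setLAverage_le_maximal μ v hy).trans (hC y))

lemma isWeight_rpow_inv (hv : IsPosMuckenhouptOne μ v) (hμ : IsDoubling μ) {s : ℝ} (hs : 1 ≤ s) :
    IsWeight μ fun x => (v x ^ s⁻¹).toReal := by
  have hs_inv : 0 ≤ s⁻¹ := by positivity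
  refine isWeight_toReal hμ (hv.measurable.pow_const _) (hv.ae_rpow_ne_top hs_inv) fun x =>
    ⟨1, one_pos, (laverage_rpow_inv_le hv.measurable.aemeasurable hs).trans_lt ?_⟩
  exact ENNReal.rpow_lt_top_of_nonneg hs_inv (hv.setLAverage_ne_top hμ x one_pos)

theorem muckenhouptAOne_rpow_inv (hv : IsPosMuckenhouptOne μ v) (hμ : IsDoubling μ) {s : ℝ}
    (hs : 1 ≤ s) : MuckenhouptAOne μ fun x => (v x ^ s⁻¹).toReal := by
  have hs_inv : 0 ≤ s⁻¹ := by positivity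
  obtain ⟨C, hC0, hC⟩ := hv.exists_setLAverage_rpow_le hs_inv
  refine ⟨hv.isWeight_rpow_inv hμ hs, C, fun x r _ => ?_⟩
  have hae := ae_restrict_of_ae (s := ball x r) (ofReal_toReal_ae_eq (hv.ae_rpow_ne_top hs_inv))
  rw [laverage_congr hae, essInf_congr_ae hae]
  refine le_mul_essInf hC0 ((ae_restrict_mem measurableSet_ball).mono fun y hy => ?_)
  exact (laverage_rpow_inv_le hv.measurable.aemeasurable hs).trans (hC x r y hy)

theorem reverseHolder_rpow_inv (hv : IsPosMuckenhouptOne μ v) (hμ : IsDoubling μ) {s : ℝ}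
    (hs : 1 ≤ s) : ReverseHolder μ s fun x => (v x ^ s⁻¹).toReal := by
  have hs_inv : 0 ≤ s⁻¹ := by positivity
  obtain ⟨C, -, hC⟩ := hv.exists_setLAverage_rpow_le hs_inv
  refine ⟨hv.isWeight_rpow_inv hμ hs, C, fun x r hr => ?_⟩
  have := hμ.isFiniteMeasure_restrict_ball x r
  have := hμ.neZero_restrict_ball x hr
  have hae := ae_restrict_of_ae (s := ball x r) (ofReal_toReal_ae_eq (hv.ae_rpow_ne_top hs_inv))
  have hpow : (fun y => ENNReal.ofReal (v y ^ s⁻¹).toReal ^ s) =ᵐ[μ.restrict (ball x r)] v :=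
    hae.mono fun y hy => by simp only [hy, ENNReal.rpow_inv_rpow (by positivity : s ≠ 0)]
  rw [laverage_congr hae, laverage_congr hpow, one_div,
    ← laverage_const_mul (hv.measurable.pow_const _).aemeasurable]
  exact le_laverage_of_ae_le ((ae_restrict_mem measurableSet_ball).mono (hC x r))

lemma isWeight_rpow_one_sub (hv : IsPosMuckenhouptOne μ v) (hμ : IsDoubling μ) {p : ℝ}
    (hp : 1 ≤ p) : IsWeight μ fun x => (v x ^ (1 - p)).toReal := by
  obtain ⟨C, hC⟩ := hv.exists_rpow_one_sub_le hp
  refine isWeight_toReal hμ (hv.measurable.pow_const _) (.of_forall (hv.rpow_one_sub_ne_top hp))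
    fun x => ⟨1, one_pos, (laverage_le_of_ae_le
      ((ae_restrict_mem measurableSet_ball).mono (hC x 1))).trans_lt ?_⟩
  have := hμ.isFiniteMeasure_restrict_ball x 1
  have := hμ.neZero_restrict_ball x one_pos
  have hne := laverage_ne_zero (ν := μ.restrict (ball x 1)) hv.measurable.aemeasurable
    (.of_forall hv.ne_zero)
  refine ENNReal.mul_lt_top ENNReal.coe_lt_top (Ne.lt_top ?_)
  simp [ENNReal.rpow_eq_top_iff, hne, hp]

theorem muckenhouptA_rpow_one_sub (hv : IsPosMuckenhouptOne μ v) (hμ : IsDoubling μ) {p : ℝ}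
    (hp : 1 < p) : MuckenhouptA μ p fun x => (v x ^ (1 - p)).toReal := by
  obtain ⟨C, hC⟩ := hv.exists_rpow_one_sub_le hp.le
  have hdual (y : X) : (v y ^ (1 - p)) ^ (-(1 / (p - 1))) = v y := by
    have hexp : (1 - p) * -(1 / (p - 1)) = 1 := by
      rw [← neg_sub p 1, neg_mul_neg, mul_one_div_cancel (sub_pos.2 hp).ne']
    rw [← ENNReal.rpow_mul, hexp, ENNReal.rpow_one]
  refine ⟨hv.isWeight_rpow_one_sub hμ hp.le, lt_of_le_of_lt ?_ (ENNReal.coe_lt_top (r := C))⟩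
  refine iSup_le fun x => iSup₂_le fun r hr => ?_
  simp only [ENNReal.ofReal_toReal (hv.rpow_one_sub_ne_top hp.le _), hdual]
  calc (⨍⁻ y in ball x r, v y ^ (1 - p) ∂μ) * (⨍⁻ y in ball x r, v y ∂μ) ^ (p - 1)
      ≤ C * (⨍⁻ y in ball x r, v y ∂μ) ^ (1 - p) * (⨍⁻ y in ball x r, v y ∂μ) ^ (p - 1) := by
        gcongr ?_ * _
        exact laverage_le_of_ae_le ((ae_restrict_mem measurableSet_ball).mono (hC x r))
    _ ≤ C * 1 := by
        rw [mul_assoc, ← neg_sub p 1, ENNReal.rpow_neg]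
        gcongr
        exact ENNReal.inv_mul_le_one _
    _ = C := mul_one _

theorem reverseHolderTop_rpow_one_sub (hv : IsPosMuckenhouptOne μ v) (hμ : IsDoubling μ) {p : ℝ}
    (hp : 1 < p) : ReverseHolderTop μ fun x => (v x ^ (1 - p)).toReal := by
  obtain ⟨C, hC⟩ := hv.exists_rpow_one_sub_le hp.le
  refine ⟨hv.isWeight_rpow_one_sub hμ hp.le, C, fun x r hr => ?_⟩
  have := hμ.isFiniteMeasure_restrict_ball x r
  have := hμ.neZero_restrict_ball x hr
  simp only [ENNReal.ofReal_toReal (hv.rpow_one_sub_ne_top hp.le _)]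
  calc essSup (fun y => v y ^ (1 - p)) (μ.restrict (ball x r))
      ≤ C * (⨍⁻ y in ball x r, v y ∂μ) ^ (1 - p) :=
        essSup_le_of_ae_le _ ((ae_restrict_mem measurableSet_ball).mono (hC x r))
    _ ≤ C * ⨍⁻ y in ball x r, v y ^ (1 - p) ∂μ := by
        gcongr
        exact rpow_one_sub_laverage_le hv.measurable.aemeasurable (.of_forall hv.ne_zero)
          (ae_restrict_of_ae hv.ae_ne_top) hp

end IsPosMuckenhouptOne

/-! ### Factorization of `A_p ∩ RH_s` -/

lemma exists_measurable_ne_zero_ne_top_ae_eq {Y : Type*} [MeasurableSpace Y] {ν : Measure Y}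
    {w : Y → ℝ} (hw : AEMeasurable w ν) (hpos : ∀ᵐ y ∂ν, 0 < w y) :
    ∃ V : Y → ℝ≥0∞, Measurable V ∧ (∀ x, V x ≠ 0) ∧ (∀ x, V x ≠ ∞) ∧
      V =ᵐ[ν] fun x => ENNReal.ofReal (w x) := by
  obtain ⟨V, hV, hV_range, hVw⟩ := hw.ennreal_ofReal.exists_ae_eq_range_subset (t := {0, ∞}ᶜ)
    (hpos.mono fun x hx => by simp [hx]) ⟨1, by simp⟩
  have hV_mem (x : Y) : V x ≠ 0 ∧ V x ≠ ∞ := by simpa using hV_range (mem_range_self x)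
  exact ⟨V, hV, fun x => (hV_mem x).1, fun x => (hV_mem x).2, hVw.symm⟩

lemma lintegral_rpow_inv_mul_lintegral_rpow_inv {Y : Type*} [MeasurableSpace Y] {ν : Measure Y}
    [IsFiniteMeasure ν] {p q : ℝ} (hpq : p.HolderConjugate q) (F G : Y → ℝ≥0∞) :
    (∫⁻ y, F y ∂ν) ^ p⁻¹ * (∫⁻ y, G y ∂ν) ^ q⁻¹ =
      (⨍⁻ y, F y ∂ν) ^ p⁻¹ * (⨍⁻ y, G y ∂ν) ^ q⁻¹ * ν univ := by
  have hp := hpq.inv_pos.le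
  have hq := hpq.symm.inv_pos.le
  rw [← measure_mul_laverage ν F, ← measure_mul_laverage ν G, ENNReal.mul_rpow_of_nonneg _ _ hp,
    ENNReal.mul_rpow_of_nonneg _ _ hq, mul_mul_mul_comm, ← ENNReal.rpow_add_of_nonneg _ _ hp hq,
    hpq.inv_add_inv_eq_one, ENNReal.rpow_one, mul_comm]

section Zero

variable {X : Type*} [MetricSpace X] [MeasurableSpace X]

lemma isWeight_zero (μ : Measure X) : IsWeight μ fun _ => (0 : ℝ) :=
  ⟨.of_forall fun _ => le_rfl, locallyIntegrable_zero⟩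

lemma muckenhouptA_zero (μ : Measure X) (p : ℝ) : MuckenhouptA μ p fun _ => 0 :=
  ⟨isWeight_zero μ, by simp [muckenhouptConst]⟩

lemma muckenhouptAOne_zero (μ : Measure X) : MuckenhouptAOne μ fun _ => 0 :=
  ⟨isWeight_zero μ, 0, fun x r _ => by simp⟩

lemma reverseHolder_zero (μ : Measure X) {s : ℝ} (hs : 0 < s) : ReverseHolder μ s fun _ => 0 :=
  ⟨isWeight_zero μ, 0, fun x r _ => by
    simp [ENNReal.zero_rpow_of_pos hs, ENNReal.zero_rpow_of_pos (inv_pos.2 hs)]⟩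

lemma reverseHolderTop_zero (μ : Measure X) : ReverseHolderTop μ fun _ => 0 :=
  ⟨isWeight_zero μ, 0, fun x r _ => essSup_le_of_ae_le _ (.of_forall fun _ => by simp)⟩

end Zero

section Factorization

variable {X : Type*} [MetricSpace X] [MeasurableSpace X] {μ : Measure X} {p s : ℝ} {w : X → ℝ}

lemma MuckenhouptA.setLAverage_mul_le (hw : MuckenhouptA μ p w) (x : X) {r : ℝ} (hr : 0 < r) :
    (⨍⁻ y in ball x r, ENNReal.ofReal (w y) ∂μ) *
      (⨍⁻ y in ball x r, ENNReal.ofReal (w y) ^ (-(1 / (p - 1))) ∂μ) ^ (p - 1) ≤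
      (muckenhouptConst μ p w).toNNReal := by
  rw [ENNReal.coe_toNNReal hw.2.ne]
  exact le_iSup_of_le x (le_iSup₂_of_le r hr le_rfl)

lemma IsWeight.aemeasurable [BorelSpace X] (hw : IsWeight μ w) (hμ : IsDoubling μ) :
    AEMeasurable w μ :=
  have := hμ.secondCountableTopology
  hw.2.aestronglyMeasurable.aemeasurable

lemma MuckenhouptA.ae_restrict_ball_pos [BorelSpace X] (hw : MuckenhouptA μ p w)
    (hμ : IsDoubling μ) (hp : 1 < p) {x : X} {r : ℝ} (h : ¬ ∀ᵐ y ∂μ.restrict (ball x r), w y = 0) :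
    ∀ᵐ y ∂μ.restrict (ball x r), 0 < w y := by
  have := hμ.isFiniteMeasure_restrict_ball x r
  have hr : 0 < r := by
    by_contra! hr
    simp [ball_eq_empty.2 hr] at h
  have hm := (hw.1.aemeasurable hμ).ennreal_ofReal.restrict (s := ball x r)
  have havg : ⨍⁻ y in ball x r, ENNReal.ofReal (w y) ∂μ ≠ 0 := by
    rw [laverage_eq]
    refine (ENNReal.div_pos (fun hzero => h ?_) (measure_ne_top _ univ)).ne'
    filter_upwards [(lintegral_eq_zero_iff' hm).1 hzero, ae_restrict_of_ae hw.1.1] with y hy hy0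
    exact le_antisymm (ENNReal.ofReal_eq_zero.1 hy) hy0
  have hdual : ⨍⁻ y in ball x r, ENNReal.ofReal (w y) ^ (-(1 / (p - 1))) ∂μ ≠ ∞ := by
    intro htop
    have hle := hw.setLAverage_mul_le x hr
    rw [htop, ENNReal.top_rpow_of_pos (sub_pos.2 hp), ENNReal.mul_top havg] at hle
    exact ENNReal.coe_ne_top (top_le_iff.1 hle)
  have hdual_int : ∫⁻ y in ball x r, ENNReal.ofReal (w y) ^ (-(1 / (p - 1))) ∂μ ≠ ∞ := by
    rw [← measure_mul_laverage]
    exact ENNReal.mul_ne_top (measure_ne_top _ _) hdual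
  filter_upwards [ae_lt_top' (hm.pow_const _) hdual_int] with y hy
  by_contra! hle
  rw [ENNReal.ofReal_of_nonpos hle, ENNReal.zero_rpow_of_neg (by simpa using hp)] at hy
  exact lt_irrefl _ hy

lemma ae_of_forall_ae_restrict_ball {P : X → Prop} (x₀ : X) (r₀ : ℝ)
    (h : ∀ r, r₀ ≤ r → ∀ᵐ y ∂μ.restrict (ball x₀ r), P y) : ∀ᵐ y ∂μ, P y := by
  rw [← Measure.restrict_univ (μ := μ), ← iUnion_ball_nat x₀, ae_restrict_iUnion_iff]
  exact fun n => ae_restrict_of_ae_restrict_of_subset (ball_subset_ball (le_max_left _ r₀))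
    (h _ (le_max_right _ _))

lemma MuckenhouptA.ae_eq_zero_or_ae_pos [BorelSpace X] (hw : MuckenhouptA μ p w)
    (hμ : IsDoubling μ) (hp : 1 < p) : (∀ᵐ x ∂μ, w x = 0) ∨ ∀ᵐ x ∂μ, 0 < w x := by
  refine or_iff_not_imp_left.2 fun hzero => ?_
  have : ∃ x₀ r₀, ¬ ∀ᵐ y ∂μ.restrict (ball x₀ r₀), w y = 0 := by
    by_contra! hall
    rcases isEmpty_or_nonempty X with hX | ⟨⟨x₀⟩⟩
    · exact hzero (.of_forall hX.elim)
    · exact hzero (ae_of_forall_ae_restrict_ball x₀ 0 fun r _ => hall x₀ r)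
  obtain ⟨x₀, r₀, hball⟩ := this
  exact ae_of_forall_ae_restrict_ball x₀ r₀ fun r hr => hw.ae_restrict_ball_pos hμ hp
    fun h => hball (ae_restrict_of_ae_restrict_of_subset (ball_subset_ball hr) h)

lemma MuckenhouptA.exists_setLAverage_rpow_mul_le (hA : MuckenhouptA μ p w)
    (hR : ReverseHolder μ s w) : ∃ C : ℝ≥0, ∀ (x : X) (r : ℝ), 0 < r →
      (⨍⁻ y in ball x r, ENNReal.ofReal (w y) ^ s ∂μ) ^ s⁻¹ *
        (⨍⁻ y in ball x r, ENNReal.ofReal (w y) ^ (-(1 / (p - 1))) ∂μ) ^ (p - 1) ≤ C := by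
  obtain ⟨C, hC⟩ := hR.2
  refine ⟨C * (muckenhouptConst μ p w).toNNReal, fun x r hr => ?_⟩
  rw [← one_div]
  refine (mul_le_mul_left (hC x r hr) _).trans ?_
  rw [mul_assoc, ENNReal.coe_mul]
  exact mul_le_mul_right (hA.setLAverage_mul_le x hr) _

-- The exponent is chosen so that `w ^ s` and `w` have the same dual weight `w ^ (-1 / (p - 1))`.
lemma isMuckenhouptPair_rpow (hμ : IsDoubling μ) (hp : 1 < p) (hs : 0 < s)
    (hA : MuckenhouptA μ p w) (hR : ReverseHolder μ s w) {V : X → ℝ≥0∞} (hV : Measurable V)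
    (hV0 : ∀ x, V x ≠ 0) (hVt : ∀ x, V x ≠ ∞) (hVw : V =ᵐ[μ] fun x => ENNReal.ofReal (w x)) :
    IsMuckenhouptPair μ (s * (p - 1) + 1) (s * (p - 1) + 1).conjExponent
      (fun x => V x ^ s) fun x => V x ^ (-(1 / (p - 1))) := by
  have hp_sub : 0 < p - 1 := sub_pos.2 hp
  have hconj := Real.HolderConjugate.conjExponent
    (lt_add_of_pos_left 1 (mul_pos hs hp_sub))
  set P := s * (p - 1) + 1 with hP
  have hP_inv : P⁻¹ = s⁻¹ * (s / P) := by field_simp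
  have hQ_inv : P.conjExponent⁻¹ = (p - 1) * (s / P) := by
    rw [← hconj.one_sub_inv, hP]
    field_simp
    ring
  refine ⟨hconj, hV.pow_const _, hV.pow_const _, fun x => ?_, ?_⟩
  · rw [← ENNReal.rpow_mul, ← ENNReal.rpow_mul, ← ENNReal.rpow_add _ _ (hV0 x) (hVt x), hQ_inv]
    convert ENNReal.rpow_zero
    field_simp
    ring
  obtain ⟨C, hC⟩ := hA.exists_setLAverage_rpow_mul_le hR
  refine ⟨C ^ (s / P), fun x r hr => ?_⟩
  have := hμ.isFiniteMeasure_restrict_ball x r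
  have havg (t : ℝ) : ⨍⁻ y in ball x r, V y ^ t ∂μ =
      ⨍⁻ y in ball x r, ENNReal.ofReal (w y) ^ t ∂μ :=
    laverage_congr ((ae_restrict_of_ae hVw).mono fun y hy => by simp only [hy])
  have hexp_nonneg : 0 ≤ s / P := div_nonneg hs.le hconj.nonneg
  rw [lintegral_rpow_inv_mul_lintegral_rpow_inv hconj, Measure.restrict_apply_univ, havg, havg,
    hP_inv, hQ_inv, ENNReal.rpow_mul, ENNReal.rpow_mul,
    ← ENNReal.mul_rpow_of_nonneg _ _ hexp_nonneg, ENNReal.coe_rpow_of_nonneg _ hexp_nonneg]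
  gcongr
  exact hC x r hr

theorem exists_eq_mul_of_muckenhouptA_of_reverseHolder [BorelSpace X] (hμ : IsDoubling μ)
    (hp : 1 < p) (hs : 1 ≤ s) (hA : MuckenhouptA μ p w) (hR : ReverseHolder μ s w) :
    ∃ w₁ w₂ : X → ℝ, (MuckenhouptAOne μ w₁ ∧ ReverseHolder μ s w₁) ∧
      (MuckenhouptA μ p w₂ ∧ ReverseHolderTop μ w₂) ∧ w =ᵐ[μ] fun x => w₁ x * w₂ x := by
  have hs0 : 0 < s := by linarith
  rcases hA.ae_eq_zero_or_ae_pos hμ hp with hzero | hpos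
  · exact ⟨_, _, ⟨muckenhouptAOne_zero μ, reverseHolder_zero μ hs0⟩,
      ⟨muckenhouptA_zero μ p, reverseHolderTop_zero μ⟩, hzero.mono fun x hx => by simp [hx]⟩
  obtain ⟨V, hV, hV0, hVt, hVw⟩ :=
    exists_measurable_ne_zero_ne_top_ae_eq (hA.1.aemeasurable hμ) hpos
  obtain ⟨v₁, v₂, h₁, h₂, hfactor⟩ :=
    (isMuckenhouptPair_rpow hμ hp hs0 hA hR hV hV0 hVt hVw).exists_factorization hμ
  refine ⟨_, _, ⟨h₁.muckenhouptAOne_rpow_inv hμ hs, h₁.reverseHolder_rpow_inv hμ hs⟩,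
    ⟨h₂.muckenhouptA_rpow_one_sub hμ hp, h₂.reverseHolderTop_rpow_one_sub hμ hp⟩, ?_⟩
  filter_upwards [hfactor, hpos, hVw] with x hx hx_pos hxw
  have hexp : 1 - (s * (p - 1) + 1) = (1 - p) * s := by ring
  have hroot : V x = v₁ x ^ s⁻¹ * v₂ x ^ (1 - p) := by
    rw [← ENNReal.rpow_rpow_inv hs0.ne' (V x), hx, hexp, ENNReal.rpow_mul,
      ENNReal.mul_rpow_of_nonneg _ _ (inv_nonneg.2 hs0.le), ENNReal.rpow_rpow_inv hs0.ne']
  rw [← ENNReal.toReal_mul, ← hroot, hxw, ENNReal.toReal_ofReal hx_pos.le]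

end Factorization

/-! ### Products of weights -/

section Average

variable {Y : Type*} [MeasurableSpace Y] {ν : Measure Y} {a b : Y → ℝ≥0∞} {c : ℝ≥0∞}

lemma laverage_mul_le_of_ae_le (ha : AEMeasurable a ν) (h : ∀ᵐ y ∂ν, b y ≤ c) :
    ⨍⁻ y, a y * b y ∂ν ≤ c * ⨍⁻ y, a y ∂ν := by
  rw [← laverage_const_mul ha]
  refine laverage_mono_ae (h.mono fun y hy => ?_)
  exact (mul_le_mul_right hy _).trans_eq (mul_comm _ _)

lemma mul_laverage_le_of_ae_le (hb : AEMeasurable b ν) (h : ∀ᵐ y ∂ν, c ≤ a y) :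
    c * ⨍⁻ y, b y ∂ν ≤ ⨍⁻ y, a y * b y ∂ν := by
  rw [← laverage_const_mul hb]
  exact laverage_mono_ae (h.mono fun y hy => mul_le_mul_left hy _)

lemma setLAverage_comp_congr {w w' : Y → ℝ} (h : w =ᵐ[ν] w') (g : ℝ → ℝ≥0∞) (t : Set Y) :
    ⨍⁻ y in t, g (w y) ∂ν = ⨍⁻ y in t, g (w' y) ∂ν :=
  laverage_congr ((ae_restrict_of_ae h).mono fun _ => congrArg g)

lemma laverage_ofReal_mul_rpow_neg_le {u v : Y → ℝ} {τ : ℝ} (hu : 0 ≤ᵐ[ν] u)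
    (hv : AEMeasurable v ν) (hτ : 0 ≤ τ) :
    ⨍⁻ y, ENNReal.ofReal (u y * v y) ^ (-τ) ∂ν ≤
      essInf (fun y => ENNReal.ofReal (u y)) ν ^ (-τ) *
        ⨍⁻ y, ENNReal.ofReal (v y) ^ (-τ) ∂ν := by
  have hmul : ∀ᵐ y ∂ν, ENNReal.ofReal (u y * v y) ^ (-τ) =
      ENNReal.ofReal (v y) ^ (-τ) * ENNReal.ofReal (u y) ^ (-τ) := by
    filter_upwards [hu] with y hy
    rw [ENNReal.ofReal_mul hy, ENNReal.mul_rpow_of_ne_top ENNReal.ofReal_ne_top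
      ENNReal.ofReal_ne_top, mul_comm]
  have hu_ge : ∀ᵐ y ∂ν, essInf (fun y => ENNReal.ofReal (u y)) ν ≤ ENNReal.ofReal (u y) :=
    ae_essInf_le
  rw [laverage_congr hmul]
  refine laverage_mul_le_of_ae_le (hv.ennreal_ofReal.pow_const _) (hu_ge.mono fun y hy => ?_)
  rw [ENNReal.rpow_neg, ENNReal.rpow_neg]
  gcongr

end Average

section Product

variable {X : Type*} [MetricSpace X] [MeasurableSpace X] {μ : Measure X} {p s : ℝ}
  {w w' w₁ w₂ : X → ℝ}

lemma IsWeight.congr (hw : IsWeight μ w) (h : w =ᵐ[μ] w') : IsWeight μ w' := by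
  refine ⟨hw.1.trans_eq h, fun x => ?_⟩
  obtain ⟨t, ht, hint⟩ := hw.2 x
  exact ⟨t, ht, hint.congr (ae_restrict_of_ae h)⟩

lemma MuckenhouptA.congr (hw : MuckenhouptA μ p w) (h : w =ᵐ[μ] w') : MuckenhouptA μ p w' := by
  have hconst : muckenhouptConst μ p w' = muckenhouptConst μ p w := by
    simp only [muckenhouptConst, setLAverage_comp_congr h ENNReal.ofReal,
      setLAverage_comp_congr h fun a => ENNReal.ofReal a ^ (-(1 / (p - 1)))]
  exact ⟨hw.1.congr h, hconst.trans_lt hw.2⟩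

lemma ReverseHolder.congr (hw : ReverseHolder μ s w) (h : w =ᵐ[μ] w') : ReverseHolder μ s w' := by
  obtain ⟨C, hC⟩ := hw.2
  refine ⟨hw.1.congr h, C, fun x r hr => ?_⟩
  rw [← setLAverage_comp_congr h ENNReal.ofReal,
    ← setLAverage_comp_congr h fun a => ENNReal.ofReal a ^ s]
  exact hC x r hr

lemma IsWeight.eventually_setLAverage_lt_top (hw : IsWeight μ w) (x : X) :
    ∀ᶠ r in nhdsWithin 0 (Ioi 0), ⨍⁻ y in ball x r, ENNReal.ofReal (w y) ∂μ < ∞ := by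
  obtain ⟨t, ht, hint⟩ := hw.2 x
  obtain ⟨ε, hε, hball⟩ := Metric.mem_nhds_iff.1 ht
  filter_upwards [Ioo_mem_nhdsGT hε] with r hr
  refine setLAverage_lt_top (ne_of_lt ?_)
  rw [← hasFiniteIntegral_iff_ofReal (ae_restrict_of_ae hw.1)]
  exact (hint.mono_set ((ball_subset_ball hr.2.le).trans hball)).2

variable [BorelSpace X]

lemma ReverseHolderTop.exists_setLAverage_mul_le (h₂ : ReverseHolderTop μ w₂)
    (h₁ : IsWeight μ w₁) (hμ : IsDoubling μ) : ∃ C : ℝ≥0, ∀ (x : X) (r : ℝ), 0 < r →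
      ⨍⁻ y in ball x r, ENNReal.ofReal (w₁ y * w₂ y) ∂μ ≤
        C * (⨍⁻ y in ball x r, ENNReal.ofReal (w₂ y) ∂μ) *
          ⨍⁻ y in ball x r, ENNReal.ofReal (w₁ y) ∂μ := by
  obtain ⟨C, hC⟩ := h₂.2
  refine ⟨C, fun x r hr => ?_⟩
  have hmul : ∀ᵐ y ∂μ.restrict (ball x r), ENNReal.ofReal (w₁ y * w₂ y) =
      ENNReal.ofReal (w₁ y) * ENNReal.ofReal (w₂ y) :=
    (ae_restrict_of_ae h₁.1).mono fun y => ENNReal.ofReal_mul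
  rw [laverage_congr hmul]
  exact laverage_mul_le_of_ae_le (h₁.aemeasurable hμ).ennreal_ofReal.restrict
    ((ENNReal.ae_le_essSup _).mono fun y hy => hy.trans (hC x r hr))

lemma IsWeight.mul (h₁ : IsWeight μ w₁) (h₂ : ReverseHolderTop μ w₂) (hμ : IsDoubling μ) :
    IsWeight μ fun x => w₁ x * w₂ x := by
  obtain ⟨C, hC⟩ := h₂.exists_setLAverage_mul_le h₁ hμ
  refine isWeight_of_setLAverage_lt_top hμ
    ((h₁.aemeasurable hμ).mul (h₂.1.aemeasurable hμ)).aestronglyMeasurable ?_ fun x => ?_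
  · filter_upwards [h₁.1, h₂.1.1] with x hx₁ hx₂ using mul_nonneg hx₁ hx₂
  · obtain ⟨r, ⟨hfin₁, hfin₂⟩, hr⟩ := ((h₁.eventually_setLAverage_lt_top x).and
      (h₂.1.eventually_setLAverage_lt_top x)).and self_mem_nhdsWithin |>.exists
    exact ⟨r, hr, (hC x r hr).trans_lt
      (ENNReal.mul_lt_top (ENNReal.mul_lt_top ENNReal.coe_lt_top hfin₂) hfin₁)⟩

theorem MuckenhouptA.mul_of_muckenhouptAOne (h₁ : MuckenhouptAOne μ w₁) (h₂ : MuckenhouptA μ p w₂)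
    (h₂' : ReverseHolderTop μ w₂) (hμ : IsDoubling μ) (hp : 1 < p) :
    MuckenhouptA μ p fun x => w₁ x * w₂ x := by
  obtain ⟨C₁, hC₁⟩ := h₁.2
  obtain ⟨C₂, hC₂⟩ := h₂'.exists_setLAverage_mul_le h₁.1 hμ
  refine ⟨h₁.1.mul h₂' hμ, lt_of_le_of_lt (iSup_le fun x => iSup₂_le fun r hr => ?_)
    (ENNReal.coe_lt_top (r := C₂ * C₁ * (muckenhouptConst μ p w₂).toNNReal))⟩
  have hp_sub : 0 < p - 1 := sub_pos.2 hp
  set τ := 1 / (p - 1) with hτ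
  set α := essInf (fun y => ENNReal.ofReal (w₁ y)) (μ.restrict (ball x r))
  have hdual : ⨍⁻ y in ball x r, ENNReal.ofReal (w₁ y * w₂ y) ^ (-τ) ∂μ ≤
      α ^ (-τ) * ⨍⁻ y in ball x r, ENNReal.ofReal (w₂ y) ^ (-τ) ∂μ :=
    laverage_ofReal_mul_rpow_neg_le (ae_restrict_of_ae h₁.1.1) (h₂.1.aemeasurable hμ).restrict
      (one_div_pos.2 hp_sub).le
  have hα : (α ^ (-τ)) ^ (p - 1) = α⁻¹ := by
    rw [← ENNReal.rpow_mul, hτ, neg_mul, one_div_mul_cancel hp_sub.ne', ENNReal.rpow_neg_one]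
  calc (⨍⁻ y in ball x r, ENNReal.ofReal (w₁ y * w₂ y) ∂μ) *
        (⨍⁻ y in ball x r, ENNReal.ofReal (w₁ y * w₂ y) ^ (-τ) ∂μ) ^ (p - 1)
      ≤ C₂ * (⨍⁻ y in ball x r, ENNReal.ofReal (w₂ y) ∂μ) * (C₁ * α) *
        (α ^ (-τ) * ⨍⁻ y in ball x r, ENNReal.ofReal (w₂ y) ^ (-τ) ∂μ) ^ (p - 1) :=
        mul_le_mul' ((hC₂ x r hr).trans (mul_le_mul_right (hC₁ x r hr) _))
          (ENNReal.rpow_le_rpow hdual hp_sub.le)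
    _ = C₂ * C₁ * ((⨍⁻ y in ball x r, ENNReal.ofReal (w₂ y) ∂μ) *
        (⨍⁻ y in ball x r, ENNReal.ofReal (w₂ y) ^ (-τ) ∂μ) ^ (p - 1)) * (α * α⁻¹) := by
        rw [ENNReal.mul_rpow_of_nonneg _ _ hp_sub.le, hα]
        ring
    _ ≤ C₂ * C₁ * (muckenhouptConst μ p w₂).toNNReal * 1 := by
        gcongr
        · exact h₂.setLAverage_mul_le x hr
        · exact ENNReal.mul_inv_le_one α
    _ = ↑(C₂ * C₁ * (muckenhouptConst μ p w₂).toNNReal) := by push_cast; ring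

theorem ReverseHolder.mul_of_muckenhouptAOne (h₁ : MuckenhouptAOne μ w₁)
    (h₁' : ReverseHolder μ s w₁) (h₂ : ReverseHolderTop μ w₂) (hμ : IsDoubling μ) (hs : 0 < s) :
    ReverseHolder μ s fun x => w₁ x * w₂ x := by
  obtain ⟨C₁, hC₁⟩ := h₁.2
  obtain ⟨C₂, hC₂⟩ := h₁'.2
  obtain ⟨C₃, hC₃⟩ := h₂.2
  refine ⟨h₁.1.mul h₂ hμ, C₃ * C₂ * C₁, fun x r hr => ?_⟩
  set α := essInf (fun y => ENNReal.ofReal (w₁ y)) (μ.restrict (ball x r))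
  set β := essSup (fun y => ENNReal.ofReal (w₂ y)) (μ.restrict (ball x r))
  have hmul : ∀ᵐ y ∂μ.restrict (ball x r), ENNReal.ofReal (w₁ y * w₂ y) =
      ENNReal.ofReal (w₁ y) * ENNReal.ofReal (w₂ y) :=
    (ae_restrict_of_ae h₁.1.1).mono fun y => ENNReal.ofReal_mul
  have hmul_rpow : ∀ᵐ y ∂μ.restrict (ball x r), ENNReal.ofReal (w₁ y * w₂ y) ^ s =
      ENNReal.ofReal (w₁ y) ^ s * ENNReal.ofReal (w₂ y) ^ s :=
    hmul.mono fun y hy => by rw [hy, ENNReal.mul_rpow_of_nonneg _ _ hs.le]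
  have hupper : ⨍⁻ y in ball x r, ENNReal.ofReal (w₁ y * w₂ y) ^ s ∂μ ≤
      β ^ s * ⨍⁻ y in ball x r, ENNReal.ofReal (w₁ y) ^ s ∂μ := by
    rw [laverage_congr hmul_rpow]
    exact laverage_mul_le_of_ae_le ((h₁.1.aemeasurable hμ).ennreal_ofReal.restrict.pow_const _)
      ((ENNReal.ae_le_essSup _).mono fun y hy => ENNReal.rpow_le_rpow hy hs.le)
  have hlower : α * ⨍⁻ y in ball x r, ENNReal.ofReal (w₂ y) ∂μ ≤
      ⨍⁻ y in ball x r, ENNReal.ofReal (w₁ y * w₂ y) ∂μ := by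
    rw [laverage_congr hmul]
    exact mul_laverage_le_of_ae_le (h₂.1.aemeasurable hμ).ennreal_ofReal.restrict ae_essInf_le
  calc (⨍⁻ y in ball x r, ENNReal.ofReal (w₁ y * w₂ y) ^ s ∂μ) ^ (1 / s)
      ≤ β * (⨍⁻ y in ball x r, ENNReal.ofReal (w₁ y) ^ s ∂μ) ^ (1 / s) := by
        refine (ENNReal.rpow_le_rpow hupper (by positivity)).trans_eq ?_
        rw [ENNReal.mul_rpow_of_nonneg _ _ (by positivity), one_div, ENNReal.rpow_rpow_inv hs.ne']
    _ ≤ C₃ * (⨍⁻ y in ball x r, ENNReal.ofReal (w₂ y) ∂μ) * (C₂ * (C₁ * α)) :=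
        mul_le_mul' (hC₃ x r hr) ((hC₂ x r hr).trans (mul_le_mul_right (hC₁ x r hr) _))
    _ = ↑(C₃ * C₂ * C₁) * (α * ⨍⁻ y in ball x r, ENNReal.ofReal (w₂ y) ∂μ) := by
        push_cast; ring
    _ ≤ ↑(C₃ * C₂ * C₁) * ⨍⁻ y in ball x r, ENNReal.ofReal (w₁ y * w₂ y) ∂μ :=
        mul_le_mul_right hlower _

end Product

end JonesFactorization

theorem mainTheorem3_general {X : Type*} [MetricSpace X] [MeasurableSpace X] [BorelSpace X]
    (μ : Measure X) (hμ : JonesFactorization.IsDoubling μ) (p s : ℝ) (hp : 1 < p) (hs : 1 ≤ s)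
    (w : X → ℝ) :
    (JonesFactorization.MuckenhouptA μ p w ∧ JonesFactorization.ReverseHolder μ s w) ↔
      ∃ w₁ w₂ : X → ℝ,
        (JonesFactorization.MuckenhouptAOne μ w₁ ∧ JonesFactorization.ReverseHolder μ s w₁) ∧
        (JonesFactorization.MuckenhouptA μ p w₂ ∧ JonesFactorization.ReverseHolderTop μ w₂) ∧
        w =ᵐ[μ] fun x => w₁ x * w₂ x := by
  constructor
  · rintro ⟨hA, hR⟩
    exact JonesFactorization.exists_eq_mul_of_muckenhouptA_of_reverseHolder hμ hp hs hA hR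
  · rintro ⟨w₁, w₂, ⟨h₁, h₁'⟩, ⟨h₂, h₂'⟩, hw⟩
    exact ⟨(JonesFactorization.MuckenhouptA.mul_of_muckenhouptAOne h₁ h₂ h₂' hμ hp).congr hw.symm,
      (JonesFactorization.ReverseHolder.mul_of_muckenhouptAOne h₁ h₁' h₂' hμ
        (zero_lt_one.trans_le hs)).congr hw.symm⟩

theorem mainTheorem3 {X : Type*} [MetricSpace X] [CompleteSpace X] [MeasurableSpace X]
    [BorelSpace X] (μ : Measure X) (hμ : JonesFactorization.IsDoubling μ)
    (hA : JonesFactorization.HasAnnularDecay μ) (p s : ℝ) (hp : 1 < p) (hs : 1 < s)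
    (w : X → ℝ) :
    (JonesFactorization.MuckenhouptA μ p w ∧ JonesFactorization.ReverseHolder μ s w) ↔
      ∃ w₁ w₂ : X → ℝ,
        (JonesFactorization.MuckenhouptAOne μ w₁ ∧ JonesFactorization.ReverseHolder μ s w₁) ∧
        (JonesFactorization.MuckenhouptA μ p w₂ ∧ JonesFactorization.ReverseHolderTop μ w₂) ∧
        w =ᵐ[μ] fun x => w₁ x * w₂ x := by
  exact mainTheorem3_general μ hμ p s hp hs.le w
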